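/- **Notation.** Let $\gamma\in\mathbb C$ with $\Re\gamma>0$. Write $(x;q)_n=\prod_{i=0}^{n-1}(1-xq^i)$ and $(x;q)_\infty=\prod_{i\ge 0}(1-xq^i)$. For complex $x$ set $\zeta(x;\gamma)_\infty=\prod_{k\ge 0}\zeta((x+k)\gamma)$ (with $\zeta$ the Riemann zeta function), and for a positive integer $m$ set $J(m|\,x;\gamma)_\infty=\prod_{p\mid m}(p^{-x\gamma};p^{-\gamma})_\infty$ (product over primes $p \mid m$). In both cases a list of arguments denotes the product over the list: $\zeta(x_1,\dots,x_r;\gamma)_\infty=\prod_i\zeta(x_i;\gamma)_\infty$ and $J(m|\,x_1,\dots,x_r;\gamma)_\infty=\prod_i J(m|\,x_i;\gamma)_\infty$. Let $S_m$ be the set of positive integers all of whose prime factors divide $m$ (so $1\in S_m$). For complex $a,b,c$ and an integer $k\ge 1$, let $$\theta(k)=\prod_{p\mid k}\left.\frac{(q^{2a};q)_n\,(-q^{1+a};q)_n\,(q^{b};q)_n\,(q^{c};q)_n}{(q;q)_n\,(-q^{a};q)_n\,(q^{2a+1-b};q)_n\,(q^{2a+1-c};q)_n}\right|_{\;q^x=p^{-x\gamma},\;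 n=v_p(k)},$$ where the product is over the primes $p \mid k$ and $v_p(k)$ is the exponent of $p$ in $k$. Define $${}_4\Theta_3\left[\begin{matrix}2a,\,-\backslash 1+a,\,b,\,c;\ \gamma,\,(1+a-b-c)\gamma\\ -\backslash a,\,2a+1-b,\,2a+1-c\end{matrix}\right]=\sum_{k=1}^\infty\frac{\theta(k)}{k^{(1+a-b-c)\gamma}},$$ and let ${}_4\Theta_3[\,m|\cdots]$ be the same series with $k$ restricted to $S_m$. **Theorem (Dirichlet series analogue of Dixon's theorem).** (i) Let $a,b,c\in\mathbb C$. Suppose that $\Re(x\gamma)>1$ for each $x$ among $2a+1-b,\ 2a+1-c,\ 1+a,\ 1+a-b-c,\ 2a+1,\ 1-b+a,\ 1-c+a,\ 2a+1-b-c$, and that $p^{-a\gamma}\ne-1$ for every prime $p$. Then the eight infinite products $\zeta(x;\gamma)_\infty$ converge, the denominator below is nonzero, the series converges absolutely, and $${}_4\Theta_3\left[\begin{matrix}2a,\,-\backslash 1+a,\,b,\,c;\ \gamma,\,(1+a-b-c)\gamma\\ -\backslash a,\,2a+1-b,\,2a+1-c\end{matrix}\right]=\frac{\zeta(2a+1-b,\,2a+1-c,\,1+a,\,1+a-b-c;\gamma)_\infty}{\zeta(2a+1,\,1-b+a,\,1-c+a,\,2a+1-b-c;\gamma)_\infty}.$$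 (ii) Let $a,b,c\in\mathbb C$ and let $m$ be a positive integer. Suppose that $\Re((1+a-b-c)\gamma)>0$ and that, for every prime $p\mid m$ and every integer $j\ge 0$, $p^{-(a+j)\gamma}\ne-1$ and none of $p^{-(2a+1-b+j)\gamma}$, $p^{-(2a+1-c+j)\gamma}$, $p^{-(1+a+j)\gamma}$ equals $1$. Then the infinite products $(p^{-x\gamma};p^{-\gamma})_\infty$ that occur below converge, the denominator is nonzero, the series converges absolutely, and $${}_4\Theta_3\left[\begin{matrix}m|\quad 2a,\,-\backslash 1+a,\,b,\,c;\ \gamma,\,(1+a-b-c)\gamma\\ -\backslash a,\,2a+1-b,\,2a+1-c\end{matrix}\right]=\frac{J(m|\ 2a+1,\,1-b+a,\,1-c+a,\,2a+1-b-c;\gamma)_\infty}{J(m|\ 2a+1-b,\,2a+1-c,\,1+a,\,1+a-b-c;\gamma)_\infty}.$$ (iii) Let $\sigma_s(k)=\sum_{d\mid k}d^s$. For integers $n,k\ge 1$ put $$\sigma_s(n;k)=\prod_{j=0}^{n-2}\frac{\sigma_s\bigl(k\prod_{p\mid k}p^j\bigr)}{\sigma_s\bigl(\prod_{p\mid k}p^j\bigr)}\qquad(\text{equal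 to }1\text{ for }n=1),$$ and $\sigma_s(n_1,\dots,n_r;k)=\prod_i\sigma_s(n_i;k)$. If $a,b,c$ are positive integers with $b,c\le 2a$, then for every $k\ge 1$ $$\theta(k)=\frac{\sigma_{-\gamma}(2a,b,c;k)\;\sigma_{-2\gamma}(1+a;k)\;\sigma_{-\gamma}(a;k)}{\sigma_{-\gamma}(2a+1-b,2a+1-c;k)\;\sigma_{-2\gamma}(a;k)\;\sigma_{-\gamma}(1+a;k)}.$$ -/

import Mathlib

/-!  Dirichlet-series analogues of basic hypergeometric series. -/

/-- The finite `q`-Pochhammer symbol `(x; q)_n = ∏_{i=0}^{n-1} (1 - x q^i)`. -/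
noncomputable def qPoch (x q : ℂ) (n : ℕ) : ℂ :=
  ∏ i ∈ Finset.range n, (1 - x * q ^ i)

/-- The infinite `q`-Pochhammer symbol `(x; q)_∞ = ∏_{i ≥ 0} (1 - x q^i)`. -/
noncomputable def qPochInf (x q : ℂ) : ℂ :=
  ∏' i : ℕ, (1 - x * q ^ i)

/-- A parameter of a series `Θ`: an ordinary parameter `x`, or a parameter `-\x`. -/
inductive DParam where
  | pos (x : ℂ) : DParam
  | neg (x : ℂ) : DParam

/-- The parameter of the underlying `q`-series with base `q = p^{-γ}`:
`x` stands for `q^x = p^{-xγ}`, and `-\x` stands for `-q^x = -p^{-xγ}`. -/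
noncomputable def DParam.localVal (γ : ℂ) (p : ℕ) : DParam → ℂ
  | .pos x => (p : ℂ) ^ (-(x * γ))
  | .neg x => -(p : ℂ) ^ (-(x * γ))

/-- The `n`-th coefficient of the basic hypergeometric series with base `q = p^{-γ}`, with upper
parameters `U` and lower parameters `L`
(one upper parameter more than lower ones):
`∏_{u ∈ U} (u; q)_n / ((q; q)_n ∏_{l ∈ L} (l; q)_n)`. -/
noncomputable def localCoeff (U L : List DParam) (γ : ℂ) (p n : ℕ) : ℂ :=
  (U.map fun u => qPoch (u.localVal γ p) ((p : ℂ) ^ (-γ)) n).prod /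
    (qPoch ((p : ℂ) ^ (-γ)) ((p : ℂ) ^ (-γ)) n *
      (L.map fun l => qPoch (l.localVal γ p) ((p : ℂ) ^ (-γ)) n).prod)

/-- The `k`-th coefficient of the Dirichlet series `Θ`: the product over the primes `p ∣ k` of the
basic hypergeometric coefficients with base `p^{-γ}` and index the exponent of `p` in `k`. -/
noncomputable def thetaCoeff (U L : List DParam) (γ : ℂ) (k : ℕ) : ℂ :=
  ∏ p ∈ k.primeFactors, localCoeff U L γ p (k.factorization p)

/-- The `k`-th term `θ(k) k^{-s}` of the Dirichlet series `Θ[U; γ, s; L]`. -/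
noncomputable def thetaTerm (U L : List DParam) (γ s : ℂ) (k : ℕ) : ℂ :=
  thetaCoeff U L γ k * (k : ℂ) ^ (-s)

/-- `ζ(x; γ)_∞ = ∏_{k ≥ 0} ζ((x + k) γ)`. -/
noncomputable def zetaPochInf (x γ : ℂ) : ℂ :=
  ∏' k : ℕ, riemannZeta ((x + k) * γ)

/-- `ζ(x₁, …, x_r; γ)_∞ = ζ(x₁; γ)_∞ ⋯ ζ(x_r; γ)_∞`. -/
noncomputable def zetaPochInfList (X : List ℂ) (γ : ℂ) : ℂ :=
  (X.map fun x => zetaPochInf x γ).prod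

/-- `J(m | x; γ)_∞ = ∏_{p ∣ m} (p^{-xγ}; p^{-γ})_∞`. -/
noncomputable def JInf (m : ℕ) (x γ : ℂ) : ℂ :=
  ∏ p ∈ m.primeFactors, qPochInf ((p : ℂ) ^ (-(x * γ))) ((p : ℂ) ^ (-γ))

/-- `J(m | x₁, …, x_r; γ)_∞ = J(m | x₁; γ)_∞ ⋯ J(m | x_r; γ)_∞`. -/
noncomputable def JInfList (m : ℕ) (X : List ℂ) (γ : ℂ) : ℂ :=
  (X.map fun x => JInf m x γ).prod

/-- The set `S_m` of the positive integers composed only of primes that divide `m`. -/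
def primeSupportedOn (m : ℕ) : Set ℕ :=
  {k | 0 < k ∧ ∀ p : ℕ, p.Prime → p ∣ k → p ∣ m}

/-- The divisor sum `σ_s(k) = ∑_{d ∣ k} d^s`. -/
noncomputable def divisorSum (s : ℂ) (k : ℕ) : ℂ :=
  ∑ d ∈ k.divisors, (d : ℂ) ^ s

/-- The symbol `σ_s(n; k) = ∏_{j=0}^{n-2} σ_s(k ∏_{p∣k} p^j) / σ_s(∏_{p∣k} p^j)`,
for positive integers `n`. -/
noncomputable def sigmaSymbol (s : ℂ) (n k : ℕ) : ℂ :=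
  ∏ j ∈ Finset.range (n - 1),
    divisorSum s (k * ∏ p ∈ k.primeFactors, p ^ j) / divisorSum s (∏ p ∈ k.primeFactors, p ^ j)

/-- `σ_s(n₁, …, n_r; k) = σ_s(n₁; k) ⋯ σ_s(n_r; k)`. -/
noncomputable def sigmaSymbolList (s : ℂ) (N : List ℕ) (k : ℕ) : ℂ :=
  (N.map fun n => sigmaSymbol s n k).prod

/-- Upper parameters `2a, -\1+a, b, c`. -/
noncomputable def dixonUpper (a b c : ℂ) : List DParam :=
  [.pos (2 * a), .neg (1 + a), .pos b, .pos c]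

/-- Lower parameters `-\a, 2a+1-b, 2a+1-c`. -/
noncomputable def dixonLower (a b c : ℂ) : List DParam :=
  [.neg a, .pos (2 * a + 1 - b), .pos (2 * a + 1 - c)]

/-- The list `2a+1-b, 2a+1-c, 1+a, 1+a-b-c`. -/
noncomputable def dixonListA (a b c : ℂ) : List ℂ :=
  [2 * a + 1 - b, 2 * a + 1 - c, 1 + a, 1 + a - b - c]

/-- The list `2a+1, 1-b+a, 1-c+a, 2a+1-b-c`. -/
noncomputable def dixonListB (a b c : ℂ) : List ℂ :=
  [2 * a + 1, 1 - b + a, 1 - c + a, 2 * a + 1 - b - c]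

/-!
At a prime `p` put `q = p^{-γ}`, `A = q^a`, `u = q^{-b}`, `v = q^{-c}`. The coefficients are
multiplicative, and the series over the powers of `p` is the `q`-Dixon series
`₄φ₃(A², -qA, 1/u, 1/v; -A, qA²u, qA²v; q, qAuv)`. Its sum (`DixonParams.hasSum_dixonTerm`) is a
quotient of infinite `q`-Pochhammer symbols. Multiplying over finitely many primes gives the series
over `S_m`; multiplying over all primes gives the full series, because the double product of
`1 - p^{-(x+k)γ}` over `p` and `k` can be evaluated in either order (`zetaPochInf_hasProd`).

The `q`-Dixon sum `F(A)` is obtained from a first order recurrence `F(A) = ρ(A) F(qA)`. It holds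
since the difference of the terms is the forward difference of an explicit multiple of the term
(`DixonParams.telescope`). Iterating it, `q^N A → 0`, the sum tends to `1`, and the products of the
`ρ(q^i A)` tend to the product side.

One estimate serves both limits: if the eight products `q A^i u^j v^k` (`i = 1, 2` and
`j, k = 0, 1`), which are the eight parameters of the product side, have norm at most `δ ≤ 1/2`,
then the term of index `n ≥ 1` is at most a constant times `δ^n`, the constant depending on a bound
for `‖q‖` only (`DixonSmall.norm_dixonTerm_succ_le`). With `δ = ‖q‖^N C` it gives the limit of
`F(q^N A)`. With `δ = p^{-t}`, `t > 1`, it gives the absolute convergence of the series over all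
positive integers: the eight hypotheses `Re (xγ) > 1` are the conditions for it.

At positive integer parameters the coefficients are products of quotients `(q^n; q)_v / (q; q)_v`,
which are telescoping products of quotients of geometric sums, that is, of divisor sums at prime
powers (`sigmaSymbol_eq_prod`).
-/

open Filter Topology

/-! ### Infinite `q`-Pochhammer symbols -/

lemma summable_norm_neg_mul_pow {q : ℂ} (hq : ‖q‖ < 1) (x : ℂ) :
    Summable fun i : ℕ => ‖-(x * q ^ i)‖ := by
  simpa only [norm_neg, norm_mul, norm_pow] using
    (summable_geometric_of_lt_one (norm_nonneg q) hq).mul_left ‖x‖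

lemma multipliable_one_sub_mul_pow {q : ℂ} (hq : ‖q‖ < 1) (x : ℂ) :
    Multipliable fun i : ℕ => 1 - x * q ^ i := by
  simpa only [sub_eq_add_neg] using
    multipliable_one_add_of_summable (summable_norm_neg_mul_pow hq x)

lemma qPochInf_ne_zero {q x : ℂ} (hq : ‖q‖ < 1) (h : ∀ i : ℕ, 1 - x * q ^ i ≠ 0) :
    qPochInf x q ≠ 0 := by
  have := tprod_one_add_ne_zero_of_summable (f := fun i : ℕ => -(x * q ^ i))
    (fun i => by simpa only [sub_eq_add_neg] using h i) (summable_norm_neg_mul_pow hq x)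
  simpa only [qPochInf, sub_eq_add_neg] using this

lemma one_sub_ne_zero_of_norm_lt_one {x : ℂ} (hx : ‖x‖ < 1) : 1 - x ≠ 0 := fun h => by
  rw [← sub_eq_zero.mp h, norm_one] at hx
  exact lt_irrefl _ hx

lemma one_sub_mul_pow_ne_zero {q x : ℂ} (hq : ‖q‖ < 1) (hx : ‖x‖ < 1) (i : ℕ) :
    1 - x * q ^ i ≠ 0 := by
  apply one_sub_ne_zero_of_norm_lt_one
  rw [norm_mul, norm_pow]
  exact (mul_le_of_le_one_right (norm_nonneg x)
    (pow_le_one₀ (norm_nonneg q) hq.le)).trans_lt hx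

lemma tendsto_qPoch {q : ℂ} (hq : ‖q‖ < 1) (x : ℂ) :
    Tendsto (qPoch x q) atTop (𝓝 (qPochInf x q)) :=
  (multipliable_one_sub_mul_pow hq x).hasProd.tendsto_prod_nat

lemma qPoch_succ (x q : ℂ) (n : ℕ) : qPoch x q (n + 1) = qPoch x q n * (1 - x * q ^ n) :=
  Finset.prod_range_succ _ _

/-! ### The nonterminating `q`-Dixon sum -/

/-- Admissible parameters for the `q`-Dixon sum
`₄φ₃(A², -qA, 1/u, 1/v; -A, qA²u, qA²v; q, qAuv)`. The parameters are the inverses `u`, `v` of the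
numerator parameters, so that the term of the series is polynomial in them. -/
structure DixonParams (q A u v : ℂ) : Prop where
  norm_q : ‖q‖ < 1
  norm_z : ‖q * A * u * v‖ < 1
  one_add_ne : ∀ j : ℕ, 1 + A * q ^ j ≠ 0
  one_sub_ne : ∀ j : ℕ, 1 - q * A * q ^ j ≠ 0
  one_sub_u_ne : ∀ j : ℕ, 1 - q * A ^ 2 * u * q ^ j ≠ 0
  one_sub_v_ne : ∀ j : ℕ, 1 - q * A ^ 2 * v * q ^ j ≠ 0

/-- The part `(A², 1/u, 1/v; q)_n / (q, qA²u, qA²v; q)_n (qAuv)^n` of the term of the `q`-Dixon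
sum. -/
noncomputable def dixonProd (q A u v : ℂ) (n : ℕ) : ℂ :=
  ∏ i ∈ Finset.range n, (1 - A ^ 2 * q ^ i) * ((u - q ^ i) * (v - q ^ i) * (q * A)) /
    ((1 - q ^ (i + 1)) * ((1 - q * A ^ 2 * u * q ^ i) * (1 - q * A ^ 2 * v * q ^ i)))

/-- The term of the `q`-Dixon sum. The quotient `(-qA; q)_n / (-A; q)_n` collapses to
`(1 + A q^n) / (1 + A)`. -/
noncomputable def dixonTerm (q A u v : ℂ) (n : ℕ) : ℂ :=
  (1 + A * q ^ n) / (1 + A) * dixonProd q A u v n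

/-- The product side of the `q`-Dixon sum. -/
noncomputable def dixonValue (q A u v : ℂ) : ℂ :=
  (qPochInf (q * A ^ 2) q * qPochInf (q * A * u) q * qPochInf (q * A * v) q *
      qPochInf (q * A ^ 2 * u * v) q) /
    (qPochInf (q * A ^ 2 * u) q * qPochInf (q * A ^ 2 * v) q * qPochInf (q * A) q *
      qPochInf (q * A * u * v) q)

/-- The quotient of `dixonValue q A u v` by `dixonValue q (q * A) u v`, with the factor `1 - qA`
cancelled. -/
noncomputable def dixonRatio (q A u v : ℂ) : ℂ :=
  (1 - q * A ^ 2) * (1 + q * A) * ((1 - q * A * u) * (1 - q * A * v)) *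
      ((1 - q * A ^ 2 * u * v) * (1 - q ^ 2 * A ^ 2 * u * v)) /
    ((1 - q * A ^ 2 * u) * (1 - q ^ 2 * A ^ 2 * u) *
      ((1 - q * A ^ 2 * v) * (1 - q ^ 2 * A ^ 2 * v)) * (1 - q * A * u * v))

namespace DixonParams

variable {q A u v : ℂ}

lemma shift (h : DixonParams q A u v) : DixonParams q (q * A) u v where
  norm_q := h.norm_q
  norm_z := by
    have : q * (q * A) * u * v = q * (q * A * u * v) := by ring
    rw [this, norm_mul]
    exact (mul_le_of_le_one_left (norm_nonneg _) h.norm_q.le).trans_lt h.norm_z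
  one_add_ne j := by convert h.one_add_ne (j + 1) using 1; ring
  one_sub_ne j := by convert h.one_sub_ne (j + 1) using 1; ring
  one_sub_u_ne j := by convert h.one_sub_u_ne (j + 2) using 1; ring
  one_sub_v_ne j := by convert h.one_sub_v_ne (j + 2) using 1; ring

lemma one_sub_pow_ne (h : DixonParams q A u v) (n : ℕ) : 1 - q ^ (n + 1) ≠ 0 := by
  rw [pow_succ']
  exact one_sub_mul_pow_ne_zero h.norm_q h.norm_q n

lemma dixonProd_succ (h : DixonParams q A u v) (n : ℕ) :
    (1 - q * q ^ n) * (1 - q * A ^ 2 * u * q ^ n) * (1 - q * A ^ 2 * v * q ^ n) *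
        dixonProd q A u v (n + 1) =
      (1 - A ^ 2 * q ^ n) * (u - q ^ n) * (v - q ^ n) * (q * A) * dixonProd q A u v n := by
  have e1 := h.one_sub_pow_ne n
  have e2 := h.one_sub_u_ne n
  have e3 := h.one_sub_v_ne n
  have s : dixonProd q A u v (n + 1) = dixonProd q A u v n * _ := Finset.prod_range_succ _ _
  rw [s, ← pow_succ', mul_div_assoc', mul_div_assoc', div_eq_iff (by positivity)]
  ring

/-- The effect of `A ↦ qA` on `dixonProd`. The factors `1 - A²`, `1 - qA²` are kept on the left, as
`1 - qA²` may vanish. -/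
lemma dixonProd_shift (h : DixonParams q A u v) (n : ℕ) :
    (1 - A ^ 2) * (1 - q * A ^ 2) *
        ((1 - q * A ^ 2 * u * q ^ n) * (1 - q ^ 2 * A ^ 2 * u * q ^ n) *
          ((1 - q * A ^ 2 * v * q ^ n) * (1 - q ^ 2 * A ^ 2 * v * q ^ n))) *
        dixonProd q (q * A) u v n =
      q ^ n * (1 - A ^ 2 * q ^ n) * (1 - q * A ^ 2 * q ^ n) *
        ((1 - q * A ^ 2 * u) * (1 - q ^ 2 * A ^ 2 * u) *
          ((1 - q * A ^ 2 * v) * (1 - q ^ 2 * A ^ 2 * v))) * dixonProd q A u v n := by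
  induction n with
  | zero => simp [dixonProd]
  | succ n ih =>
    have e1 := h.one_sub_pow_ne n
    have e2 := h.one_sub_u_ne n
    have e3 := h.one_sub_v_ne n
    have r1 := h.shift.dixonProd_succ n
    have r2 := h.dixonProd_succ n
    rw [pow_succ' q n] at e1 ⊢
    refine mul_left_cancel₀ (mul_ne_zero e1 (mul_ne_zero e2 e3)) ?_
    linear_combination (1 - A ^ 2) * (1 - q * A ^ 2) *
      ((1 - q * A ^ 2 * u * q ^ n) * (1 - q ^ 2 * A ^ 2 * u * q ^ n) *
          ((1 - q * A ^ 2 * v * q ^ n) * (1 - q ^ 2 * A ^ 2 * v * q ^ n))) * r1 +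
      (1 - q ^ 2 * A ^ 2 * q ^ n) * (u - q ^ n) * (v - q ^ n) * (q ^ 2 * A) * ih -
      q * q ^ n * (1 - A ^ 2 * (q * q ^ n)) * (1 - q * A ^ 2 * (q * q ^ n)) *
        ((1 - q * A ^ 2 * u) * (1 - q ^ 2 * A ^ 2 * u) *
          ((1 - q * A ^ 2 * v) * (1 - q ^ 2 * A ^ 2 * v))) * r2

end DixonParams

/-! ### The recurrence in `A` -/

/-- The polynomial in the certificate of the recurrence in `A`, with `e = u + v` and `f = uv`. It is
the quadratic polynomial in `x` determined by its values at `x = 0`, `x = 1 / A²` and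
`x = 1 / (qA²u)`, where one of the terms of `dixonCertPoly_identity` (in the last case, after
replacing `x` by `x / q`) vanishes. -/
noncomputable def dixonCertPoly (q A e f x : ℂ) : ℂ :=
  -(1 - A) +
    (1 - q * A * e - q * A ^ 2 * f + q ^ 2 * A * f + q ^ 2 * A ^ 2 * f * e -
      q ^ 3 * A ^ 3 * f ^ 2) * (A ^ 2 * x) * (1 - A ^ 2 * x) +
    (1 - A + A * (1 - q * e + q ^ 2 * f) * (1 - q * A * f)) * (A ^ 2 * x) ^ 2

/-- The certificate of the recurrence in `A`: its forward difference is the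
difference of the terms of `F(A)` and `ρ(A) F(qA)`, where `F` is the sum and `ρ` is `dixonRatio`. -/
noncomputable def dixonCert (q A u v : ℂ) (n : ℕ) : ℂ :=
  dixonProd q A u v n * ((1 - q ^ n) * dixonCertPoly q A (u + v) (u * v) (q ^ n)) /
    ((1 - A ^ 2) * (1 - q * A * u * v) *
      ((1 - q * A ^ 2 * u * q ^ n) * (1 - q * A ^ 2 * v * q ^ n)))

/-- The polynomial identity behind the certificate, in the elementary symmetric functions
`e = u + v` and `f = uv`; here `x` stands for `q ^ n`. -/
lemma dixonCertPoly_identity (q A e f x : ℂ) :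
    (1 - A) * (1 - q * A * f) *
        ((1 - q * A ^ 2 * e * x + q ^ 2 * A ^ 4 * f * x ^ 2) *
          (1 - q ^ 2 * A ^ 2 * e * x + q ^ 4 * A ^ 4 * f * x ^ 2)) * (1 + A * x) -
      x * (1 - A ^ 2 * x) * (1 - q * A ^ 2 * x) * (1 + q * A * x) *
        ((1 - q * A * e + q ^ 2 * A ^ 2 * f) *
          ((1 - q * A ^ 2 * f) * (1 - q ^ 2 * A ^ 2 * f))) =
      (1 - A ^ 2 * x) * (f - e * x + x ^ 2) * (q * A) * dixonCertPoly q A e f (q * x) -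
        (1 - x) * dixonCertPoly q A e f x *
          (1 - q ^ 2 * A ^ 2 * e * x + q ^ 4 * A ^ 4 * f * x ^ 2) := by
  rw [dixonCertPoly, dixonCertPoly]
  ring

namespace DixonParams

variable {q A u v : ℂ}

lemma one_sub_z_ne (h : DixonParams q A u v) : 1 - q * A * u * v ≠ 0 :=
  one_sub_ne_zero_of_norm_lt_one h.norm_z

lemma one_add_A_ne (h : DixonParams q A u v) : 1 + A ≠ 0 := by
  simpa using h.one_add_ne 0

lemma one_add_qA_ne (h : DixonParams q A u v) : 1 + q * A ≠ 0 := by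
  simpa [mul_comm] using h.one_add_ne 1

/-- After multiplication by the common denominator `M` every term is a multiple of `dixonProd`, and
`dixonCertPoly_identity` remains. -/
lemma telescope (h : DixonParams q A u v) (hA : 1 - A ≠ 0) (n : ℕ) :
    dixonTerm q A u v n - dixonRatio q A u v * dixonTerm q (q * A) u v n =
      dixonCert q A u v (n + 1) - dixonCert q A u v n := by
  have z := h.one_sub_z_ne
  have hA1 := h.one_add_A_ne
  have hA2 := h.one_add_qA_ne
  have u0 : 1 - q * A ^ 2 * u ≠ 0 := by simpa using h.one_sub_u_ne 0
  have v0 : 1 - q * A ^ 2 * v ≠ 0 := by simpa using h.one_sub_v_ne 0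
  have u1 : 1 - q ^ 2 * A ^ 2 * u ≠ 0 := by convert h.one_sub_u_ne 1 using 1; ring
  have v1 : 1 - q ^ 2 * A ^ 2 * v ≠ 0 := by convert h.one_sub_v_ne 1 using 1; ring
  have a := h.one_sub_u_ne n
  have b := h.one_sub_v_ne n
  have a' : 1 - q ^ 2 * A ^ 2 * u * q ^ n ≠ 0 := by
    convert h.one_sub_u_ne (n + 1) using 1; ring
  have b' : 1 - q ^ 2 * A ^ 2 * v * q ^ n ≠ 0 := by
    convert h.one_sub_v_ne (n + 1) using 1; ring
  have sh := h.dixonProd_shift n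
  have r := h.dixonProd_succ n
  have hAA : 1 - A ^ 2 ≠ 0 := by
    rw [show 1 - A ^ 2 = (1 - A) * (1 + A) by ring]; exact mul_ne_zero hA hA1
  set M := (1 - A ^ 2) * (1 - q * A * u * v) *
    ((1 - q * A ^ 2 * u * q ^ n) * (1 - q * A ^ 2 * v * q ^ n) *
      ((1 - q ^ 2 * A ^ 2 * u * q ^ n) * (1 - q ^ 2 * A ^ 2 * v * q ^ n))) with hM
  have hM0 : M ≠ 0 := by rw [hM]; positivity
  have t1 : M * dixonTerm q A u v n = (1 - A) * (1 - q * A * u * v) *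
      ((1 - q * A ^ 2 * u * q ^ n) * (1 - q * A ^ 2 * v * q ^ n) *
        ((1 - q ^ 2 * A ^ 2 * u * q ^ n) * (1 - q ^ 2 * A ^ 2 * v * q ^ n))) *
      (1 + A * q ^ n) * dixonProd q A u v n := by
    rw [hM, dixonTerm, div_mul_eq_mul_div, mul_div_assoc', div_eq_iff hA1]
    ring
  have t2 : M * (dixonRatio q A u v * dixonTerm q (q * A) u v n) =
      q ^ n * (1 - A ^ 2 * q ^ n) * (1 - q * A ^ 2 * q ^ n) * (1 + q * A * q ^ n) *
        ((1 - q * A * u) * (1 - q * A * v) *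
          ((1 - q * A ^ 2 * u * v) * (1 - q ^ 2 * A ^ 2 * u * v))) * dixonProd q A u v n := by
    rw [hM, dixonTerm, dixonRatio, div_mul_eq_mul_div (1 + q * A * q ^ n), div_mul_div_comm,
      mul_div_assoc', div_eq_iff (by positivity)]
    clear hM0 hM M t1 r a b a' b' u0 v0 u1 v1 z h
    generalize dixonProd q A u v n = S at *
    generalize dixonProd q (q * A) u v n = S' at *
    generalize 1 - q * A ^ 2 * u * q ^ n = a at *
    generalize 1 - q * A ^ 2 * v * q ^ n = b at *
    generalize 1 - q ^ 2 * A ^ 2 * u * q ^ n = a' at *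
    generalize 1 - q ^ 2 * A ^ 2 * v * q ^ n = b' at *
    generalize (1 - q * A ^ 2 * u) * (1 - q ^ 2 * A ^ 2 * u) *
      ((1 - q * A ^ 2 * v) * (1 - q ^ 2 * A ^ 2 * v)) = U at *
    generalize (1 - q * A ^ 2 * u * v) * (1 - q ^ 2 * A ^ 2 * u * v) = R₁
    generalize (1 - q * A * u) * (1 - q * A * v) = R₂
    generalize 1 - q * A * u * v = z
    linear_combination z * (1 + q * A) * (1 + q * A * q ^ n) * (R₂ * R₁) * sh
  have t3 : M * dixonCert q A u v (n + 1) =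
      (1 - A ^ 2 * q ^ n) * (u - q ^ n) * (v - q ^ n) * (q * A) *
        dixonCertPoly q A (u + v) (u * v) (q * q ^ n) * dixonProd q A u v n := by
    have e1 : 1 - q * A ^ 2 * u * (q * q ^ n) = 1 - q ^ 2 * A ^ 2 * u * q ^ n := by ring
    have e2 : 1 - q * A ^ 2 * v * (q * q ^ n) = 1 - q ^ 2 * A ^ 2 * v * q ^ n := by ring
    have hd := mul_ne_zero (mul_ne_zero hAA z) (mul_ne_zero a' b')
    rw [dixonCert, pow_succ' q n, e1, e2, mul_div_assoc', div_eq_iff hd, hM]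
    generalize dixonCertPoly q A (u + v) (u * v) (q * q ^ n) = P
    linear_combination (1 - A ^ 2) * (1 - q * A * u * v) *
      ((1 - q ^ 2 * A ^ 2 * u * q ^ n) * (1 - q ^ 2 * A ^ 2 * v * q ^ n)) * P * r
  have t4 : M * dixonCert q A u v n =
      (1 - q ^ n) * dixonCertPoly q A (u + v) (u * v) (q ^ n) *
        ((1 - q ^ 2 * A ^ 2 * u * q ^ n) * (1 - q ^ 2 * A ^ 2 * v * q ^ n)) *
        dixonProd q A u v n := by
    have hd := mul_ne_zero (mul_ne_zero hAA z) (mul_ne_zero a b)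
    rw [dixonCert, mul_div_assoc', div_eq_iff hd, hM]
    ring
  refine mul_left_cancel₀ hM0 ?_
  rw [mul_sub, mul_sub, t1, t2, t3, t4, ← sub_mul, ← sub_mul]
  have key := dixonCertPoly_identity q A (u + v) (u * v) (q ^ n)
  rw [show 1 - q * A ^ 2 * (u + v) * q ^ n + q ^ 2 * A ^ 4 * (u * v) * (q ^ n) ^ 2 =
      (1 - q * A ^ 2 * u * q ^ n) * (1 - q * A ^ 2 * v * q ^ n) by ring,
    show 1 - q ^ 2 * A ^ 2 * (u + v) * q ^ n + q ^ 4 * A ^ 4 * (u * v) * (q ^ n) ^ 2 =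
      (1 - q ^ 2 * A ^ 2 * u * q ^ n) * (1 - q ^ 2 * A ^ 2 * v * q ^ n) by ring,
    show 1 - q * A * (u + v) + q ^ 2 * A ^ 2 * (u * v) = (1 - q * A * u) * (1 - q * A * v) by ring,
    show u * v - (u + v) * q ^ n + (q ^ n) ^ 2 = (u - q ^ n) * (v - q ^ n) by ring] at key
  rw [← mul_assoc (q * A) u v, ← mul_assoc (q * A ^ 2) u v, ← mul_assoc (q ^ 2 * A ^ 2) u v,
    ← mul_assoc (1 - A ^ 2 * q ^ n)] at key
  rw [key]

end DixonParams

namespace DixonParams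

variable {q A u v : ℂ}

lemma dixonProd_zero : dixonProd q A u v 0 = 1 := by simp [dixonProd]

lemma dixonTerm_zero (h : DixonParams q A u v) : dixonTerm q A u v 0 = 1 := by
  simp [dixonTerm, dixonProd_zero, h.one_add_A_ne]

lemma tendsto_pow (h : DixonParams q A u v) : Tendsto (fun n : ℕ => q ^ n) atTop (𝓝 0) :=
  tendsto_pow_atTop_nhds_zero_of_norm_lt_one h.norm_q

lemma summable_dixonProd (h : DixonParams q A u v) : Summable (dixonProd q A u v) := by
  obtain ⟨r, hr, hr1⟩ := exists_between h.norm_z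
  have hcont : ContinuousAt (fun x : ℂ => (1 - A ^ 2 * x) * ((u - x) * (v - x) * (q * A)) /
      ((1 - q * x) * ((1 - q * A ^ 2 * u * x) * (1 - q * A ^ 2 * v * x)))) 0 := by
    refine ContinuousAt.div (by fun_prop) (by fun_prop) (by simp)
  have hlim := (hcont.tendsto.comp h.tendsto_pow).norm
  have h0 : ‖(1 - A ^ 2 * 0) * ((u - 0) * (v - 0) * (q * A)) /
      ((1 - q * 0) * ((1 - q * A ^ 2 * u * 0) * (1 - q * A ^ 2 * v * 0)))‖ < r := by
    convert hr using 2; ring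
  refine summable_of_ratio_norm_eventually_le hr1 ?_
  filter_upwards [hlim.eventually_le_const h0] with n hn
  have s : dixonProd q A u v (n + 1) = dixonProd q A u v n * _ := Finset.prod_range_succ _ _
  rw [s, norm_mul, mul_comm]
  refine mul_le_mul_of_nonneg_right ?_ (norm_nonneg _)
  rw [pow_succ' q n]
  exact hn

lemma summable_dixonTerm (h : DixonParams q A u v) : Summable fun n => ‖dixonTerm q A u v n‖ := by
  refine (h.summable_dixonProd.norm.mul_left ((1 + ‖A‖) / ‖1 + A‖)).of_nonneg_of_le
    (fun _ => norm_nonneg _) fun n => ?_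
  rw [dixonTerm, norm_mul, norm_div]
  gcongr
  refine (norm_add_le _ _).trans ?_
  rw [norm_one, norm_mul, norm_pow]
  gcongr
  exact mul_le_of_le_one_right (norm_nonneg A) (pow_le_one₀ (norm_nonneg q) h.norm_q.le)

lemma tendsto_dixonCert (h : DixonParams q A u v) (hA : 1 - A ≠ 0) :
    Tendsto (dixonCert q A u v) atTop (𝓝 0) := by
  have hAA : 1 - A ^ 2 ≠ 0 := by
    rw [show 1 - A ^ 2 = (1 - A) * (1 + A) by ring]; exact mul_ne_zero hA h.one_add_A_ne
  have hz := h.one_sub_z_ne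
  have hcont : ContinuousAt (fun x : ℂ => (1 - x) * dixonCertPoly q A (u + v) (u * v) x /
      ((1 - A ^ 2) * (1 - q * A * u * v) *
        ((1 - q * A ^ 2 * u * x) * (1 - q * A ^ 2 * v * x)))) 0 := by
    unfold dixonCertPoly
    refine ContinuousAt.div (by fun_prop) (by fun_prop) (by simp [hAA, hz])
  have hlim := h.summable_dixonProd.tendsto_atTop_zero.mul (hcont.tendsto.comp h.tendsto_pow)
  rw [zero_mul] at hlim
  refine hlim.congr fun n => ?_
  simp only [dixonCert, Function.comp_apply, mul_div_assoc]

/-- The recurrence `F(A) = ρ(A) F(qA)` of the sum `F`, from the vanishing of the certificate at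
`0` and at infinity. -/
lemma tsum_dixonTerm_eq (h : DixonParams q A u v) (hA : 1 - A ≠ 0) :
    ∑' n, dixonTerm q A u v n = dixonRatio q A u v * ∑' n, dixonTerm q (q * A) u v n := by
  have h1 := h.summable_dixonTerm.of_norm
  have h2 := h.shift.summable_dixonTerm.of_norm.mul_left (dixonRatio q A u v)
  have hs := (h1.sub h2).hasSum.tendsto_sum_nat
  have hc : Tendsto (fun N => ∑ n ∈ Finset.range N,
      (dixonTerm q A u v n - dixonRatio q A u v * dixonTerm q (q * A) u v n)) atTop (𝓝 0) := by
    refine (h.tendsto_dixonCert hA).congr fun N => ?_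
    rw [Finset.sum_congr rfl fun n _ => h.telescope hA n, Finset.sum_range_sub]
    simp [dixonCert]
  have := tendsto_nhds_unique hs hc
  rw [h1.tsum_sub h2, tsum_mul_left] at this
  exact sub_eq_zero.mp this

end DixonParams

/-! ### A uniform bound for the terms -/

/-- The constant in the uniform bound for the terms of the `q`-Dixon sum with base of norm at most
`r`. -/
noncomputable def dixonBound (r : ℝ) : ℝ :=
  64 / (1 - r) * Real.exp ((6 + 1 / (1 - r)) / (1 - r))

/-- The eight parameters of the product side of the `q`-Dixon sum all have norm at most `δ`. -/
structure DixonSmall (q A u v : ℂ) (δ : ℝ) : Prop where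
  qA : ‖q * A‖ ≤ δ
  qAu : ‖q * A * u‖ ≤ δ
  qAv : ‖q * A * v‖ ≤ δ
  qAuv : ‖q * A * u * v‖ ≤ δ
  qAA : ‖q * A ^ 2‖ ≤ δ
  qAAu : ‖q * A ^ 2 * u‖ ≤ δ
  qAAv : ‖q * A ^ 2 * v‖ ≤ δ
  qAAuv : ‖q * A ^ 2 * u * v‖ ≤ δ

section Bound

variable {q A u v : ℂ} {r δ : ℝ}

lemma sub_norm_le_norm_one_sub {x : ℂ} {t : ℝ} (hx : ‖x‖ ≤ t) : 1 - t ≤ ‖1 - x‖ := by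
  have := norm_sub_norm_le (1 : ℂ) x
  rw [norm_one] at this
  linarith

/-- After multiplication by `qA` the numerator factor `(u - q^i)(v - q^i)` is small, as every
monomial in its expansion is. -/
lemma DixonSmall.norm_numerator_le (h : DixonSmall q A u v δ) {x : ℂ} {t : ℝ} (ht : t ≤ 1)
    (hx : ‖x‖ ≤ t) : ‖(u - x) * (v - x) * (q * A)‖ ≤ δ * (1 + 3 * t) := by
  have h0 : 0 ≤ δ := (norm_nonneg _).trans h.qA
  have ht0 : 0 ≤ t := (norm_nonneg _).trans hx
  have e : (u - x) * (v - x) * (q * A) =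
      q * A * u * v - q * A * u * x - q * A * v * x + q * A * x * x := by ring
  rw [e]
  have b1 : ‖q * A * u * x‖ ≤ δ * t := by
    rw [norm_mul]; exact mul_le_mul h.qAu hx (norm_nonneg _) h0
  have b2 : ‖q * A * v * x‖ ≤ δ * t := by
    rw [norm_mul]; exact mul_le_mul h.qAv hx (norm_nonneg _) h0
  have b3 : ‖q * A * x * x‖ ≤ δ * t := by
    rw [norm_mul, norm_mul]
    have := mul_le_mul h.qA hx (norm_nonneg _) h0
    exact (mul_le_mul this (hx.trans ht) (norm_nonneg _) (by positivity)).trans_eq (mul_one _)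
  have := (norm_add_le (q * A * u * v - q * A * u * x - q * A * v * x) (q * A * x * x)).trans
    (add_le_add_left ((norm_sub_le _ _).trans (add_le_add_left (norm_sub_le _ _) _)) _)
  linarith [h.qAuv]

/-- The numerator of the factor of index `0` of the term, after cancellation of `1 + A`: neither `A`
nor `u` nor `v` need be small, but the expansion consists of the eight small products. -/
lemma DixonSmall.norm_first_le (h : DixonSmall q A u v δ) :
    ‖(1 - A) * ((u - 1) * (v - 1) * (q * A))‖ ≤ 8 * δ := by
  have e : (1 - A) * ((u - 1) * (v - 1) * (q * A)) =
      q * A - q * A * u - q * A * v + q * A * u * v -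
      (q * A ^ 2 - q * A ^ 2 * u - q * A ^ 2 * v + q * A ^ 2 * u * v) := by ring
  have four (a b c d : ℂ) : ‖a - b - c + d‖ ≤ ‖a‖ + ‖b‖ + ‖c‖ + ‖d‖ :=
    (norm_add_le _ _).trans
      (add_le_add_left ((norm_sub_le _ _).trans (add_le_add_left (norm_sub_le _ _) _)) _)
  rw [e]
  refine (norm_sub_le _ _).trans ?_
  linarith [four (q * A) (q * A * u) (q * A * v) (q * A * u * v),
    four (q * A ^ 2) (q * A ^ 2 * u) (q * A ^ 2 * v) (q * A ^ 2 * u * v),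
    h.qA, h.qAu, h.qAv, h.qAuv, h.qAA, h.qAAu, h.qAAv, h.qAAuv]

/-- Every further factor of the term is `δ (1 + O(‖q‖^i))`, so that the factors multiply up to at
most a constant times `δ^n`. -/
lemma DixonSmall.norm_factor_le (h : DixonSmall q A u v δ) (hr : r < 1) (hq : ‖q‖ ≤ r)
    (hδ : δ ≤ 1 / 2) (i : ℕ) :
    ‖(1 - A ^ 2 * q ^ (i + 1)) * ((u - q ^ (i + 1)) * (v - q ^ (i + 1)) * (q * A)) /
      ((1 - q ^ (i + 1 + 1)) *
        ((1 - q * A ^ 2 * u * q ^ (i + 1)) * (1 - q * A ^ 2 * v * q ^ (i + 1))))‖ ≤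
      δ * Real.exp ((6 + 1 / (1 - r)) * r ^ i) := by
  have h0 : 0 ≤ δ := (norm_nonneg _).trans h.qA
  have hr0 : 0 ≤ r := (norm_nonneg _).trans hq
  have hs : 0 < 1 - r := by linarith
  set t := r ^ i with ht
  have t0 : 0 ≤ t := pow_nonneg hr0 i
  have t1 : t ≤ 1 := pow_le_one₀ hr0 hr.le
  have hx0 : ‖q ^ i‖ ≤ t := by rw [norm_pow]; exact pow_le_pow_left₀ (norm_nonneg _) hq i
  have hx : ‖q ^ (i + 1)‖ ≤ t := by
    rw [pow_succ, norm_mul]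
    exact (mul_le_of_le_one_right (norm_nonneg _) (hq.trans hr.le)).trans hx0
  have hx1 : ‖q ^ (i + 1 + 1)‖ ≤ r * t := by
    rw [pow_succ', norm_mul]
    exact mul_le_mul hq hx (norm_nonneg _) hr0
  have n1 : ‖1 - A ^ 2 * q ^ (i + 1)‖ ≤ 1 + t := by
    refine (norm_sub_le _ _).trans ?_
    have : A ^ 2 * q ^ (i + 1) = q * A ^ 2 * q ^ i := by ring
    rw [norm_one, this, norm_mul]
    have := mul_le_mul (h.qAA.trans (hδ.trans (by norm_num : (1 / 2 : ℝ) ≤ 1))) hx0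
      (norm_nonneg _) zero_le_one
    linarith
  have n2 := h.norm_numerator_le t1 hx
  have d1 : (1 + t / (1 - r))⁻¹ ≤ ‖1 - q ^ (i + 1 + 1)‖ := by
    refine le_trans ?_ (sub_norm_le_norm_one_sub hx1)
    rw [inv_le_iff_one_le_mul₀ (by positivity)]
    have : (1 - r * t) * (1 + t / (1 - r)) - 1 = r * t * (1 - t) / (1 - r) + t * (1 - r) := by
      field_simp; ring
    have : 0 ≤ r * t * (1 - t) / (1 - r) :=
      div_nonneg (mul_nonneg (mul_nonneg hr0 t0) (by linarith)) hs.le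
    linarith [mul_nonneg t0 hs.le]
  have dd (w : ℂ) (hw : ‖w‖ ≤ δ) : (1 + t)⁻¹ ≤ ‖1 - w * q ^ (i + 1)‖ := by
    have : ‖w * q ^ (i + 1)‖ ≤ 1 / 2 * t := by
      rw [norm_mul]; exact mul_le_mul (hw.trans hδ) hx (norm_nonneg _) (by norm_num)
    refine le_trans ?_ (sub_norm_le_norm_one_sub this)
    rw [inv_le_iff_one_le_mul₀ (by positivity)]
    nlinarith
  have d2 := dd _ h.qAAu
  have d3 := dd _ h.qAAv
  have hden : ((1 + t / (1 - r)) * ((1 + t) * (1 + t)))⁻¹ ≤ ‖(1 - q ^ (i + 1 + 1)) *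
        ((1 - q * A ^ 2 * u * q ^ (i + 1)) * (1 - q * A ^ 2 * v * q ^ (i + 1)))‖ := by
    rw [norm_mul, norm_mul, mul_inv, mul_inv]
    gcongr
  have hP : 0 < (1 + t / (1 - r)) * ((1 + t) * (1 + t)) := by positivity
  rw [norm_div, norm_mul, div_le_iff₀ ((inv_pos.mpr hP).trans_le hden)]
  have key : (1 + t) * (1 + 3 * t) * ((1 + t / (1 - r)) * ((1 + t) * (1 + t))) ≤
      Real.exp ((6 + 1 / (1 - r)) * t) := by
    have e (y : ℝ) : 1 + y ≤ Real.exp y := by linarith [Real.add_one_le_exp y]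
    have : Real.exp ((6 + 1 / (1 - r)) * t) = Real.exp t * Real.exp (3 * t) *
        (Real.exp (t / (1 - r)) * (Real.exp t * Real.exp t)) := by
      simp only [← Real.exp_add]; congr 1; ring
    rw [this]
    gcongr <;> exact e _
  calc _ ≤ (1 + t) * (δ * (1 + 3 * t)) := mul_le_mul n1 n2 (norm_nonneg _) (by positivity)
    _ = δ * ((1 + t) * (1 + 3 * t) * ((1 + t / (1 - r)) * ((1 + t) * (1 + t)))) *
        ((1 + t / (1 - r)) * ((1 + t) * (1 + t)))⁻¹ := by field_simp
    _ ≤ _ := by gcongr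

/-- The terms of the `q`-Dixon sum decay geometrically, uniformly in the parameters. Both the
absolute convergence of the Euler product and the limit `A → 0` rest on this bound. -/
lemma DixonSmall.norm_dixonTerm_succ_le (h : DixonSmall q A u v δ) (hA : 1 + A ≠ 0) (hr : r < 1)
    (hq : ‖q‖ ≤ r) (hδ : δ ≤ 1 / 2) (n : ℕ) :
    ‖dixonTerm q A u v (n + 1)‖ ≤ dixonBound r * δ ^ (n + 1) := by
  have h0 : 0 ≤ δ := (norm_nonneg _).trans h.qA
  have hr0 : 0 ≤ r := (norm_nonneg _).trans hq
  have hs : 0 < 1 - r := by linarith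
  set f : ℕ → ℂ := fun i =>
    (1 - A ^ 2 * q ^ (i + 1)) * ((u - q ^ (i + 1)) * (v - q ^ (i + 1)) * (q * A)) /
      ((1 - q ^ (i + 1 + 1)) *
        ((1 - q * A ^ 2 * u * q ^ (i + 1)) * (1 - q * A ^ 2 * v * q ^ (i + 1)))) with hf
  have e : dixonTerm q A u v (n + 1) = (∏ i ∈ Finset.range n, f i) *
      ((1 + A * q ^ (n + 1)) * (((1 - A) * ((u - 1) * (v - 1) * (q * A))) /
        ((1 - q) * ((1 - q * A ^ 2 * u) * (1 - q * A ^ 2 * v))))) := by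
    rw [dixonTerm, dixonProd, Finset.prod_range_succ']
    simp only [pow_zero, zero_add, mul_one, pow_one]
    rw [show 1 - A ^ 2 = (1 - A) * (1 + A) by ring]
    change _ * ((∏ i ∈ Finset.range n, f i) * _) = _
    generalize ∏ i ∈ Finset.range n, f i = P
    field_simp
  have hprod : ‖∏ i ∈ Finset.range n, f i‖ ≤ δ ^ n * Real.exp ((6 + 1 / (1 - r)) / (1 - r)) := by
    rw [norm_prod]
    calc _ ≤ ∏ i ∈ Finset.range n, δ * Real.exp ((6 + 1 / (1 - r)) * r ^ i) :=
          Finset.prod_le_prod (fun _ _ => norm_nonneg _) fun i _ => h.norm_factor_le hr hq hδ i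
      _ = δ ^ n * Real.exp ((6 + 1 / (1 - r)) * ∑ i ∈ Finset.range n, r ^ i) := by
          rw [Finset.prod_mul_distrib, Finset.prod_const, Finset.card_range, ← Real.exp_sum,
            Finset.mul_sum]
      _ ≤ _ := by
          rw [div_eq_mul_inv (6 + 1 / (1 - r)) (1 - r)]
          gcongr
          exact ((summable_geometric_of_lt_one hr0 hr).sum_le_tsum _
            fun i _ => pow_nonneg hr0 i).trans_eq (tsum_geometric_of_lt_one hr0 hr)
  have h1 : ‖1 + A * q ^ (n + 1)‖ ≤ 2 := by
    refine (norm_add_le _ _).trans ?_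
    have : A * q ^ (n + 1) = q * A * q ^ n := by ring
    rw [norm_one, this, norm_mul, norm_pow]
    have := mul_le_mul (h.qA.trans (hδ.trans (by norm_num : (1 / 2 : ℝ) ≤ 1)))
      (pow_le_one₀ (norm_nonneg q) (hq.trans hr.le) : ‖q‖ ^ n ≤ 1) (by positivity) zero_le_one
    linarith
  have hden : (1 - r) * (1 / 2 * (1 / 2)) ≤
      ‖(1 - q) * ((1 - q * A ^ 2 * u) * (1 - q * A ^ 2 * v))‖ := by
    rw [norm_mul, norm_mul]
    have := sub_norm_le_norm_one_sub hq
    have := sub_norm_le_norm_one_sub (h.qAAu.trans hδ)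
    have := sub_norm_le_norm_one_sub (h.qAAv.trans hδ)
    gcongr <;> linarith
  have h2 : ‖(1 - A) * ((u - 1) * (v - 1) * (q * A)) /
        ((1 - q) * ((1 - q * A ^ 2 * u) * (1 - q * A ^ 2 * v)))‖ ≤ 32 * δ / (1 - r) := by
    rw [norm_div]
    calc _ ≤ 8 * δ / ((1 - r) * (1 / 2 * (1 / 2))) := by
          gcongr
          exact h.norm_first_le
      _ = _ := by field_simp; ring
  rw [e, norm_mul, norm_mul]
  calc _ ≤ δ ^ n * Real.exp ((6 + 1 / (1 - r)) / (1 - r)) * (2 * (32 * δ / (1 - r))) := by gcongr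
    _ = _ := by rw [dixonBound]; ring

end Bound

/-! ### Evaluation of the `q`-Dixon sum -/

/-- The product of the quotients `dixonRatio q (q ^ i * A) u v` over `i < N`. -/
noncomputable def dixonPartial (q A u v : ℂ) (N : ℕ) : ℂ :=
  (qPoch (q * A ^ 2) q (2 * N) * qPoch (q * A * u) q N * qPoch (q * A * v) q N *
      qPoch (q * A ^ 2 * u * v) q (2 * N)) /
    (qPoch (q * A ^ 2 * u) q (2 * N) * qPoch (q * A ^ 2 * v) q (2 * N) * qPoch (q * A) q N *
      qPoch (q * A * u * v) q N)

namespace DixonParams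

variable {q A u v : ℂ}

lemma iterate_shift (h : DixonParams q A u v) (N : ℕ) : DixonParams q (q ^ N * A) u v := by
  induction N with
  | zero => simpa using h
  | succ N ih => simpa only [pow_succ', mul_assoc] using ih.shift

lemma dixonPartial_succ (h : DixonParams q A u v) (N : ℕ) :
    dixonPartial q A u v (N + 1) = dixonPartial q A u v N * dixonRatio q (q ^ N * A) u v := by
  have hy : q ^ (2 * N) = (q ^ N) ^ 2 := by rw [mul_comm, pow_mul]
  have hne := h.one_sub_ne N
  have e : dixonRatio q (q ^ N * A) u v =
      ((1 - q * A ^ 2 * q ^ (2 * N)) * (1 - q * A ^ 2 * q ^ (2 * N + 1)) *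
        (1 - q * A * u * q ^ N) * (1 - q * A * v * q ^ N) *
        ((1 - q * A ^ 2 * u * v * q ^ (2 * N)) * (1 - q * A ^ 2 * u * v * q ^ (2 * N + 1)))) /
      ((1 - q * A ^ 2 * u * q ^ (2 * N)) * (1 - q * A ^ 2 * u * q ^ (2 * N + 1)) *
        ((1 - q * A ^ 2 * v * q ^ (2 * N)) * (1 - q * A ^ 2 * v * q ^ (2 * N + 1))) *
        (1 - q * A * q ^ N) * (1 - q * A * u * v * q ^ N)) := by
    -- `1 + q (q^N A)` is completed by `1 - q (q^N A)` to a factor of `(qA²; q)_{2N + 2}`.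
    rw [dixonRatio, ← mul_div_mul_right _ _ hne, pow_succ q (2 * N), hy]
    congr 1 <;> ring
  rw [e, dixonPartial, dixonPartial, div_mul_div_comm, show 2 * (N + 1) = 2 * N + 1 + 1 by ring]
  simp only [qPoch_succ]
  congr 1 <;> ring

lemma tendsto_dixonPartial (h : DixonParams q A u v) :
    Tendsto (dixonPartial q A u v) atTop (𝓝 (dixonValue q A u v)) := by
  have t (x : ℂ) := tendsto_qPoch h.norm_q x
  have t2 (x : ℂ) : Tendsto (fun N => qPoch x q (2 * N)) atTop (𝓝 (qPochInf x q)) :=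
    (t x).comp (tendsto_id.const_mul_atTop' two_pos)
  refine ((((t2 _).mul (t _)).mul (t _)).mul (t2 _)).div
    ((((t2 _).mul (t2 _)).mul (t _)).mul (t _)) ?_
  refine mul_ne_zero (mul_ne_zero (mul_ne_zero ?_ ?_) ?_) ?_
  · exact qPochInf_ne_zero h.norm_q h.one_sub_u_ne
  · exact qPochInf_ne_zero h.norm_q h.one_sub_v_ne
  · exact qPochInf_ne_zero h.norm_q h.one_sub_ne
  · exact qPochInf_ne_zero h.norm_q (one_sub_mul_pow_ne_zero h.norm_q h.norm_z)

lemma tsum_dixonTerm_eq_dixonPartial (h : DixonParams q A u v) (hA : 1 - A ≠ 0) (N : ℕ) :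
    ∑' n, dixonTerm q A u v n = dixonPartial q A u v N * ∑' n, dixonTerm q (q ^ N * A) u v n := by
  induction N with
  | zero => simp [dixonPartial, qPoch]
  | succ N ih =>
    have hN : 1 - q ^ N * A ≠ 0 := by
      cases N with
      | zero => simpa using hA
      | succ N => convert h.one_sub_ne N using 1; ring
    rw [ih, (h.iterate_shift N).tsum_dixonTerm_eq hN, h.dixonPartial_succ, mul_assoc,
      show q * (q ^ N * A) = q ^ (N + 1) * A by ring]

/-- As `A → 0` along `q ^ N * A`, only the term of index `0` survives. -/
lemma tendsto_tsum_dixonTerm (h : DixonParams q A u v) :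
    Tendsto (fun N : ℕ => ∑' n, dixonTerm q (q ^ N * A) u v n) atTop (𝓝 1) := by
  set C := ‖q * A‖ + ‖q * A * u‖ + ‖q * A * v‖ + ‖q * A * u * v‖ + ‖q * A ^ 2‖ +
    ‖q * A ^ 2 * u‖ + ‖q * A ^ 2 * v‖ + ‖q * A ^ 2 * u * v‖ with hC
  have small (N : ℕ) : DixonSmall q (q ^ N * A) u v (C * ‖q‖ ^ N) := by
    have hp : ‖q‖ ^ N ≤ 1 := pow_le_one₀ (norm_nonneg q) h.norm_q.le
    have e1 (w : ℂ) (hw : ‖w‖ ≤ C) : ‖w * q ^ N‖ ≤ C * ‖q‖ ^ N := by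
      rw [norm_mul, norm_pow]; gcongr
    have e2 (w : ℂ) (hw : ‖w‖ ≤ C) : ‖w * q ^ N * q ^ N‖ ≤ C * ‖q‖ ^ N := by
      rw [norm_mul, norm_pow]
      exact (mul_le_of_le_one_right (norm_nonneg _) hp).trans (e1 w hw)
    have n1 := norm_nonneg (q * A)
    have n2 := norm_nonneg (q * A * u)
    have n3 := norm_nonneg (q * A * v)
    have n4 := norm_nonneg (q * A * u * v)
    have n5 := norm_nonneg (q * A ^ 2)
    have n6 := norm_nonneg (q * A ^ 2 * u)
    have n7 := norm_nonneg (q * A ^ 2 * v)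
    have n8 := norm_nonneg (q * A ^ 2 * u * v)
    constructor
    · convert e1 (q * A) (by linarith) using 2; ring
    · convert e1 (q * A * u) (by linarith) using 2; ring
    · convert e1 (q * A * v) (by linarith) using 2; ring
    · convert e1 (q * A * u * v) (by linarith) using 2; ring
    · convert e2 (q * A ^ 2) (by linarith) using 2; ring
    · convert e2 (q * A ^ 2 * u) (by linarith) using 2; ring
    · convert e2 (q * A ^ 2 * v) (by linarith) using 2; ring
    · convert e2 (q * A ^ 2 * u * v) (by linarith) using 2; ring
  have hC0 : 0 ≤ C := by rw [hC]; positivity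
  have hδ : Tendsto (fun N : ℕ => C * ‖q‖ ^ N) atTop (𝓝 0) := by
    simpa using (tendsto_pow_atTop_nhds_zero_of_lt_one (norm_nonneg q) h.norm_q).const_mul C
  have hK : 0 ≤ dixonBound ‖q‖ := by
    have := h.norm_q
    exact mul_nonneg (div_nonneg (by norm_num) (by linarith)) (Real.exp_nonneg _)
  rw [tendsto_iff_norm_sub_tendsto_zero]
  have hlim : Tendsto (fun N : ℕ => 2 * dixonBound ‖q‖ * (C * ‖q‖ ^ N)) atTop (𝓝 0) := by
    simpa using hδ.const_mul (2 * dixonBound ‖q‖)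
  refine squeeze_zero' (Eventually.of_forall fun _ => norm_nonneg _) ?_ hlim
  filter_upwards [hδ.eventually_le_const (by norm_num : (0 : ℝ) < 1 / 2)] with N hN
  have hp := h.iterate_shift N
  set δ := C * ‖q‖ ^ N
  have hδ0 : 0 ≤ δ := by positivity
  have hδ1 : δ < 1 := by linarith
  rw [hp.summable_dixonTerm.of_norm.tsum_eq_zero_add, hp.dixonTerm_zero, add_sub_cancel_left]
  have hb := (summable_geometric_of_lt_one hδ0 hδ1).mul_left (dixonBound ‖q‖ * δ)
  refine (tsum_of_norm_bounded hb.hasSum fun n => ?_).trans ?_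
  · refine ((small N).norm_dixonTerm_succ_le hp.one_add_A_ne h.norm_q le_rfl hN n).trans_eq ?_
    rw [pow_succ']; ring
  · rw [tsum_mul_left, tsum_geometric_of_lt_one hδ0 hδ1]
    have : (1 - δ)⁻¹ ≤ 2 := by
      rw [inv_le_comm₀ (by linarith) two_pos]; linarith
    calc _ ≤ dixonBound ‖q‖ * δ * 2 := by gcongr
      _ = _ := by ring

/-- The nonterminating `q`-Dixon sum. -/
theorem hasSum_dixonTerm (h : DixonParams q A u v) :
    HasSum (dixonTerm q A u v) (dixonValue q A u v) := by
  by_cases hA : 1 - A = 0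
  -- The certificate has a pole at `A = 1`, but there the series consists of its first term only.
  · obtain rfl : A = 1 := (sub_eq_zero.mp hA).symm
    have hz : ∀ n ≠ 0, dixonTerm q 1 u v n = 0 := fun n hn => by
      rw [dixonTerm, dixonProd,
        Finset.prod_eq_zero (Finset.mem_range.mpr (Nat.pos_of_ne_zero hn)) (by simp), mul_zero]
    have h1 := qPochInf_ne_zero h.norm_q h.one_sub_u_ne
    have h2 := qPochInf_ne_zero h.norm_q h.one_sub_v_ne
    have h3 := qPochInf_ne_zero h.norm_q h.one_sub_ne
    have h4 := qPochInf_ne_zero h.norm_q (one_sub_mul_pow_ne_zero h.norm_q h.norm_z)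
    have hv : dixonValue q 1 u v = dixonTerm q 1 u v 0 := by
      rw [h.dixonTerm_zero, dixonValue]
      simp only [one_pow, mul_one] at h1 h2 h3 h4 ⊢
      rw [div_eq_one_iff_eq (by positivity)]
      ring
    rw [hv]
    exact hasSum_single 0 hz
  · have lim := h.tendsto_dixonPartial.mul h.tendsto_tsum_dixonTerm
    rw [mul_one] at lim
    have := tendsto_nhds_unique
      (lim.congr fun N => (h.tsum_dixonTerm_eq_dixonPartial hA N).symm) tendsto_const_nhds
    rw [this]
    exact h.summable_dixonTerm.of_norm.hasSum

end DixonParams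

/-! ### Sums of multiplicative functions -/

section Multiplicative

variable {f : ℕ → ℂ}

/-- The finite Euler product. Only the primes in `s` need a convergent local series. -/
lemma hasSum_factoredNumbers_of_multiplicative (hf1 : f 1 = 1)
    (hmul : ∀ {m n : ℕ}, m.Coprime n → f (m * n) = f m * f n) (s : Finset ℕ)
    (hs : ∀ p ∈ s, p.Prime) (hsum : ∀ p ∈ s, Summable fun n : ℕ => ‖f (p ^ n)‖) :
    Summable (fun m : Nat.factoredNumbers s => ‖f m‖) ∧
      HasSum (fun m : Nat.factoredNumbers s => f m) (∏ p ∈ s, ∑' n : ℕ, f (p ^ n)) := by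
  induction s using Finset.induction with
  | empty =>
    rw [Nat.factoredNumbers_empty]
    simp only [Finset.prod_empty]
    exact ⟨(Set.finite_singleton 1).summable (‖f ·‖), hf1 ▸ hasSum_singleton 1 f⟩
  | insert p s hp ih =>
    have hpp := hs p (Finset.mem_insert_self p s)
    have hps := hsum p (Finset.mem_insert_self p s)
    obtain ⟨ih1, ih2⟩ := ih (fun r hr => hs r (Finset.mem_insert_of_mem hr))
      (fun r hr => hsum r (Finset.mem_insert_of_mem hr))
    have e (x : ℕ × Nat.factoredNumbers s) :
        f (Nat.equivProdNatFactoredNumbers hpp hp x) = f (p ^ x.1) * f x.2 := by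
      rw [Nat.equivProdNatFactoredNumbers_apply',
        Nat.factoredNumbers.map_prime_pow_mul hmul hpp hp]
    have hprod : Summable fun x : ℕ × Nat.factoredNumbers s => ‖f (p ^ x.1) * f x.2‖ := by
      simp only [norm_mul]
      exact hps.mul_of_nonneg ih1 (fun _ => norm_nonneg _) (fun _ => norm_nonneg _)
    constructor
    · rw [← (Nat.equivProdNatFactoredNumbers hpp hp).summable_iff]
      exact hprod.congr fun x => by rw [Function.comp_apply, e]
    · rw [Finset.prod_insert hp, ← (Nat.equivProdNatFactoredNumbers hpp hp).hasSum_iff]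
      have : T3Space ℂ := inferInstance
      have key : HasSum (fun x : ℕ × Nat.factoredNumbers s => f (p ^ x.1) * f x.2)
          ((∑' n : ℕ, f (p ^ n)) * ∏ p ∈ s, ∑' n : ℕ, f (p ^ n)) := by
        apply hps.of_norm.hasSum.mul ih2
        exact hprod.of_norm
      simpa only [Function.comp_def, e] using key

/-- A multiplicative function is absolutely summable once the sum of its values at the nontrivial
prime powers is: the partial sums are bounded by the product of `1 + δ p`. -/
lemma summable_norm_of_multiplicative (hf0 : f 0 = 0) (hf1 : f 1 = 1)
    (hmul : ∀ {m n : ℕ}, m.Coprime n → f (m * n) = f m * f n) {δ : ℕ → ℝ} (hδ : Summable δ)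
    (hδ0 : ∀ p, 0 ≤ δ p) (hsum : ∀ p : ℕ, p.Prime → Summable fun n : ℕ => ‖f (p ^ n)‖)
    (hle : ∀ p : ℕ, p.Prime → ∑' n : ℕ, ‖f (p ^ (n + 1))‖ ≤ δ p) :
    Summable fun n => ‖f n‖ := by
  refine summable_of_sum_range_le (c := Real.exp (∑' p, δ p)) (fun _ => norm_nonneg _) fun N => ?_
  have hH := (EulerProduct.summable_and_hasSum_smoothNumbers_prod_primesBelow_tsum
    (f := fun n => ‖f n‖) (by simp [hf1]) (fun h => by rw [hmul h, norm_mul])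
    (fun {p} hp => by simpa only [norm_norm] using hsum p hp) N).2
  have hI : HasSum ((Nat.smoothNumbers N).indicator fun n => ‖f n‖) _ :=
    hasSum_subtype_iff_indicator.mp hH
  calc ∑ i ∈ Finset.range N, ‖f i‖
      = ∑ i ∈ Finset.range N, (Nat.smoothNumbers N).indicator (fun n => ‖f n‖) i := by
        refine Finset.sum_congr rfl fun i hi => ?_
        rcases Nat.eq_zero_or_pos i with rfl | hi0
        · rw [Set.indicator_of_notMem fun h => Nat.ne_zero_of_mem_smoothNumbers h rfl, hf0,
            norm_zero]
        · rw [Set.indicator_of_mem]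
          exact Nat.mem_smoothNumbers_of_lt hi0 (Finset.mem_range.mp hi)
    _ ≤ ∏ p ∈ N.primesBelow, ∑' n : ℕ, ‖f (p ^ n)‖ :=
        sum_le_hasSum _ (fun i _ => Set.indicator_nonneg (fun _ _ => norm_nonneg _) i) hI
    _ ≤ ∏ p ∈ N.primesBelow, Real.exp (δ p) := by
        refine Finset.prod_le_prod (fun p _ => tsum_nonneg fun _ => norm_nonneg _) fun p hp => ?_
        have hpp := Nat.prime_of_mem_primesBelow hp
        rw [(hsum p hpp).tsum_eq_zero_add, pow_zero, hf1, norm_one]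
        linarith [hle p hpp, Real.add_one_le_exp (δ p)]
    _ = Real.exp (∑ p ∈ N.primesBelow, δ p) := (Real.exp_sum _ _).symm
    _ ≤ _ := Real.exp_le_exp.mpr (hδ.sum_le_tsum _ fun p _ => hδ0 p)

end Multiplicative

/-! ### The coefficients of the Dirichlet series -/

section Coefficients

variable (U L : List DParam) (γ s : ℂ)

lemma localCoeff_zero (p : ℕ) : localCoeff U L γ p 0 = 1 := by
  simp [localCoeff, qPoch]

lemma thetaCoeff_one : thetaCoeff U L γ 1 = 1 := by simp [thetaCoeff]

lemma thetaCoeff_prime_pow {p : ℕ} (hp : p.Prime) (n : ℕ) :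
    thetaCoeff U L γ (p ^ n) = localCoeff U L γ p n := by
  rcases eq_or_ne n 0 with rfl | hn
  · rw [pow_zero, thetaCoeff_one, localCoeff_zero]
  · rw [thetaCoeff, Nat.primeFactors_prime_pow hn hp, Finset.prod_singleton,
      hp.factorization_pow, Finsupp.single_eq_same]

lemma thetaCoeff_mul {m n : ℕ} (h : m.Coprime n) :
    thetaCoeff U L γ (m * n) = thetaCoeff U L γ m * thetaCoeff U L γ n := by
  rw [thetaCoeff, h.primeFactors_mul, Finset.prod_union h.disjoint_primeFactors]
  congr 1
  · refine Finset.prod_congr rfl fun p hp => ?_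
    rw [Nat.factorization_eq_of_coprime_left h (Nat.mem_primeFactors_iff_mem_primeFactorsList.mp hp)]
  · refine Finset.prod_congr rfl fun p hp => ?_
    rw [Nat.factorization_eq_of_coprime_right h
      (Nat.mem_primeFactors_iff_mem_primeFactorsList.mp hp)]

lemma thetaTerm_one : thetaTerm U L γ s 1 = 1 := by simp [thetaTerm, thetaCoeff_one]

lemma thetaTerm_zero (hs : s ≠ 0) : thetaTerm U L γ s 0 = 0 := by simp [thetaTerm, hs]

lemma thetaTerm_mul {m n : ℕ} (h : m.Coprime n) :
    thetaTerm U L γ s (m * n) = thetaTerm U L γ s m * thetaTerm U L γ s n := by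
  rw [thetaTerm, thetaTerm, thetaTerm, thetaCoeff_mul U L γ h, Nat.cast_mul,
    Complex.natCast_mul_natCast_cpow]
  ring

lemma thetaTerm_prime_pow {p : ℕ} (hp : p.Prime) (n : ℕ) :
    thetaTerm U L γ s (p ^ n) = localCoeff U L γ p n * ((p : ℂ) ^ (-s)) ^ n := by
  rw [thetaTerm, thetaCoeff_prime_pow U L γ hp, Nat.cast_pow, ← Complex.natCast_cpow_natCast_mul,
    Complex.cpow_nat_mul]

end Coefficients

/-! ### The local factors -/

section Local

variable {p : ℕ} (a b c γ : ℂ)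

lemma cpow_two_mul_a : (p : ℂ) ^ (-(2 * a * γ)) = ((p : ℂ) ^ (-(a * γ))) ^ 2 := by
  rw [← Complex.cpow_nat_mul]; congr 1; push_cast; ring

lemma cpow_one_add_a (hp : p ≠ 0) :
    (p : ℂ) ^ (-((1 + a) * γ)) = (p : ℂ) ^ (-γ) * (p : ℂ) ^ (-(a * γ)) := by
  rw [← Complex.cpow_add _ _ (Nat.cast_ne_zero.mpr hp)]; congr 1; ring

lemma cpow_two_mul_a_add_one (hp : p ≠ 0) :
    (p : ℂ) ^ (-((2 * a + 1) * γ)) = (p : ℂ) ^ (-γ) * ((p : ℂ) ^ (-(a * γ))) ^ 2 := by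
  rw [← cpow_two_mul_a a γ, ← Complex.cpow_add _ _ (Nat.cast_ne_zero.mpr hp)]; congr 1; ring

lemma cpow_sub_mul (x : ℂ) (hp : p ≠ 0) :
    (p : ℂ) ^ (-((x - b) * γ)) = (p : ℂ) ^ (-(x * γ)) * (p : ℂ) ^ (b * γ) := by
  rw [← Complex.cpow_add _ _ (Nat.cast_ne_zero.mpr hp)]; congr 1; ring

lemma cpow_add_nat_mul (x : ℂ) (hp : p ≠ 0) (j : ℕ) :
    (p : ℂ) ^ (-((x + j) * γ)) = (p : ℂ) ^ (-(x * γ)) * ((p : ℂ) ^ (-γ)) ^ j := by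
  rw [← Complex.cpow_nat_mul, ← Complex.cpow_add _ _ (Nat.cast_ne_zero.mpr hp)]; congr 1; ring

lemma qPoch_inv_mul_pow {u q : ℂ} (hu : u ≠ 0) (n : ℕ) :
    qPoch u⁻¹ q n * u ^ n = ∏ i ∈ Finset.range n, (u - q ^ i) := by
  rw [qPoch, ← Finset.card_range n, ← Finset.prod_const, Finset.card_range,
    ← Finset.prod_mul_distrib]
  refine Finset.prod_congr rfl fun i _ => ?_
  field_simp

/-- Both sides are `(x; q)_{n+1}`. -/
lemma qPoch_base_mul (x q : ℂ) (n : ℕ) :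
    qPoch (q * x) q n * (1 - x) = qPoch x q n * (1 - x * q ^ n) := by
  induction n with
  | zero => simp [qPoch]
  | succ n ih =>
    rw [qPoch_succ, qPoch_succ]
    linear_combination (1 - q * x * q ^ n) * ih

lemma qPoch_ne_zero {x q : ℂ} (h : ∀ j : ℕ, 1 - x * q ^ j ≠ 0) (n : ℕ) : qPoch x q n ≠ 0 :=
  Finset.prod_ne_zero_iff.mpr fun j _ => h j

/-- The parameters at `p` of the local series, in the variables of the `q`-Dixon sum. -/
abbrev LocalDixonParams (a b c γ : ℂ) (p : ℕ) : Prop :=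
  DixonParams ((p : ℂ) ^ (-γ)) ((p : ℂ) ^ (-(a * γ))) ((p : ℂ) ^ (b * γ)) ((p : ℂ) ^ (c * γ))

lemma localCoeff_mul_pow (hp : p ≠ 0) (h : LocalDixonParams a b c γ p) (n : ℕ) :
    localCoeff (dixonUpper a b c) (dixonLower a b c) γ p n *
        ((p : ℂ) ^ (-((1 + a - b - c) * γ))) ^ n =
      dixonTerm ((p : ℂ) ^ (-γ)) ((p : ℂ) ^ (-(a * γ))) ((p : ℂ) ^ (b * γ))
        ((p : ℂ) ^ (c * γ)) n := by
  have hp' : (p : ℂ) ≠ 0 := Nat.cast_ne_zero.mpr hp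
  simp only [localCoeff, dixonUpper, dixonLower, DParam.localVal, List.map_cons, List.map_nil,
    List.prod_cons, List.prod_nil, mul_one]
  simp only [cpow_sub_mul _ γ _ hp]
  rw [cpow_two_mul_a a γ, cpow_one_add_a a γ hp, cpow_two_mul_a_add_one a γ hp,
    Complex.cpow_neg _ (b * γ), Complex.cpow_neg _ (c * γ)]
  have hu : (p : ℂ) ^ (b * γ) ≠ 0 := by simp [Complex.cpow_eq_zero_iff, hp']
  have hv : (p : ℂ) ^ (c * γ) ≠ 0 := by simp [Complex.cpow_eq_zero_iff, hp']
  unfold LocalDixonParams at h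
  generalize (p : ℂ) ^ (-γ) = q at *
  generalize (p : ℂ) ^ (-(a * γ)) = A at *
  generalize (p : ℂ) ^ (b * γ) = u at *
  generalize (p : ℂ) ^ (c * γ) = v at *
  have e : dixonProd q A u v n = qPoch (A ^ 2) q n *
      ((qPoch u⁻¹ q n * u ^ n) * (qPoch v⁻¹ q n * v ^ n) * (q * A) ^ n) /
      (qPoch q q n * (qPoch (q * A ^ 2 * u) q n * qPoch (q * A ^ 2 * v) q n)) := by
    rw [qPoch_inv_mul_pow hu, qPoch_inv_mul_pow hv, dixonProd, Finset.prod_div_distrib]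
    simp only [Finset.prod_mul_distrib, Finset.prod_const, Finset.card_range, pow_succ', qPoch, mul_pow]
  have hA := h.one_add_A_ne
  have n1 : qPoch (-A) q n ≠ 0 := qPoch_ne_zero (fun j => by simpa using h.one_add_ne j) n
  have s : qPoch (-(q * A)) q n = qPoch (-A) q n * (1 + A * q ^ n) / (1 + A) := by
    rw [eq_div_iff hA]
    simpa using qPoch_base_mul (-A) q n
  rw [dixonTerm, e, s, mul_pow _ v, mul_pow _ u]
  generalize qPoch u⁻¹ q n = Pu
  generalize qPoch v⁻¹ q n = Pv
  field_simp

lemma hasSum_thetaTerm_prime_pow (hp : p.Prime) (h : LocalDixonParams a b c γ p) :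
    (Summable fun n : ℕ => ‖thetaTerm (dixonUpper a b c) (dixonLower a b c) γ
      ((1 + a - b - c) * γ) (p ^ n)‖) ∧
    HasSum (fun n : ℕ => thetaTerm (dixonUpper a b c) (dixonLower a b c) γ
      ((1 + a - b - c) * γ) (p ^ n))
      (dixonValue ((p : ℂ) ^ (-γ)) ((p : ℂ) ^ (-(a * γ))) ((p : ℂ) ^ (b * γ))
        ((p : ℂ) ^ (c * γ))) := by
  simp only [thetaTerm_prime_pow _ _ _ _ hp, localCoeff_mul_pow a b c γ hp.ne_zero h]
  exact ⟨h.summable_dixonTerm, h.hasSum_dixonTerm⟩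

/-- The product side of the local `q`-Dixon sum in terms of the two parameter lists. -/
lemma dixonValue_local (hp : p ≠ 0) :
    dixonValue ((p : ℂ) ^ (-γ)) ((p : ℂ) ^ (-(a * γ))) ((p : ℂ) ^ (b * γ)) ((p : ℂ) ^ (c * γ)) =
      ((dixonListB a b c).map fun x => qPochInf ((p : ℂ) ^ (-(x * γ))) ((p : ℂ) ^ (-γ))).prod /
        ((dixonListA a b c).map fun x =>
          qPochInf ((p : ℂ) ^ (-(x * γ))) ((p : ℂ) ^ (-γ))).prod := by
  simp only [dixonListA, dixonListB, List.map_cons, List.map_nil, List.prod_cons, List.prod_nil,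
    mul_one]
  rw [show 1 - b + a = 1 + a - b by ring, show 1 - c + a = 1 + a - c by ring]
  simp only [cpow_sub_mul _ γ _ hp, cpow_one_add_a a γ hp, cpow_two_mul_a_add_one a γ hp]
  rw [dixonValue]
  congr 1 <;> ring

end Local

/-! ### The infinite products of zeta values -/

section Zeta

lemma norm_prime_cpow_neg_lt_one {p : ℕ} (hp : p.Prime) {s : ℂ} (hs : 0 < s.re) :
    ‖(p : ℂ) ^ (-s)‖ < 1 := by
  rw [Complex.norm_natCast_cpow_of_pos hp.pos, Complex.neg_re]
  exact Real.rpow_lt_one_of_one_lt_of_neg (by exact_mod_cast hp.one_lt) (by linarith)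

lemma norm_prime_cpow_neg_le {p : ℕ} (hp : p.Prime) {s : ℂ} {t : ℝ} (hs : t ≤ s.re) :
    ‖(p : ℂ) ^ (-s)‖ ≤ (p : ℝ) ^ (-t) := by
  rw [Complex.norm_natCast_cpow_of_pos hp.pos, Complex.neg_re]
  exact Real.rpow_le_rpow_of_exponent_le (by exact_mod_cast hp.one_lt.le) (by linarith)

lemma norm_prime_cpow_neg_le_two {p : ℕ} (hp : p.Prime) {s : ℂ} (hs : 0 < s.re) :
    ‖(p : ℂ) ^ (-s)‖ ≤ (2 : ℝ) ^ (-s.re) := by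
  rw [Complex.norm_natCast_cpow_of_pos hp.pos, Complex.neg_re]
  exact Real.rpow_le_rpow_of_nonpos two_pos (by exact_mod_cast hp.two_le) (by linarith)

/-- The double product of `1 - p^{-(x+k)γ}` over primes `p` and indices `k` converges absolutely;
multiplying first over `p` gives the zeta values, multiplying first over `k` gives the infinite
`q`-Pochhammer symbols. -/
lemma zetaPochInf_hasProd {x γ : ℂ} (hγ : 0 < γ.re) (hx : 1 < (x * γ).re) :
    (Multipliable fun k : ℕ => riemannZeta ((x + k) * γ)) ∧ zetaPochInf x γ ≠ 0 ∧
      HasProd (fun p : Nat.Primes => qPochInf ((p : ℂ) ^ (-(x * γ))) ((p : ℂ) ^ (-γ)))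
        (zetaPochInf x γ)⁻¹ := by
  set F : ℕ × Nat.Primes → ℂ := fun kp =>
    -((kp.2 : ℂ) ^ (-(x * γ)) * ((kp.2 : ℂ) ^ (-γ)) ^ kp.1) with hF
  have hr : (2 : ℝ) ^ (-γ.re) < 1 := Real.rpow_lt_one_of_one_lt_of_neg one_lt_two (by linarith)
  have hsum : Summable fun kp => ‖F kp‖ := by
    have h1 : Summable fun k : ℕ => ((2 : ℝ) ^ (-γ.re)) ^ k :=
      summable_geometric_of_lt_one (by positivity) hr
    have h2 : Summable fun p : Nat.Primes => ((p : ℕ) : ℝ) ^ (-(x * γ).re) :=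
      Nat.Primes.summable_rpow.mpr (by linarith)
    refine (h1.mul_of_nonneg h2 (fun _ => by positivity) (fun _ => by positivity)).of_nonneg_of_le
      (fun _ => norm_nonneg _) fun kp => ?_
    rw [hF, norm_neg, norm_mul, norm_pow, mul_comm]
    gcongr
    · exact norm_prime_cpow_neg_le_two kp.2.2 hγ
    · exact norm_prime_cpow_neg_le kp.2.2 le_rfl
  have hlt (p : Nat.Primes) : ‖(p : ℂ) ^ (-γ)‖ < 1 := norm_prime_cpow_neg_lt_one p.2 hγ
  have hne : ∀ kp, 1 + F kp ≠ 0 := fun kp => by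
    rw [hF, ← sub_eq_add_neg]
    exact one_sub_mul_pow_ne_zero (hlt kp.2)
      (norm_prime_cpow_neg_lt_one kp.2.2 (by linarith)) kp.1
  have hprod := (multipliable_one_add_of_summable hsum).hasProd
  have hW := tprod_one_add_ne_zero_of_summable hne hsum
  set W := ∏' kp, (1 + F kp)
  have hz : HasProd (fun k : ℕ => riemannZeta ((x + k) * γ)) W⁻¹ := by
    refine (hprod.inv₀ hW).prod_fiberwise fun k => ?_
    have hk : 1 < ((x + k) * γ).re := by
      have e : ((k : ℂ) * γ).re = k * γ.re := by simp
      rw [add_mul, Complex.add_re, e]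
      have : 0 ≤ (k : ℝ) * γ.re := by positivity
      linarith
    refine (riemannZeta_eulerProduct_hasProd hk).congr_fun ?_
    intro p
    rw [hF, ← sub_eq_add_neg, cpow_add_nat_mul γ x p.2.ne_zero]
  have hpoch : HasProd (fun p : Nat.Primes => qPochInf ((p : ℂ) ^ (-(x * γ))) ((p : ℂ) ^ (-γ)))
      W := by
    refine ((Equiv.prodComm Nat.Primes ℕ).hasProd_iff.mpr hprod).prod_fiberwise fun p => ?_
    have := (multipliable_one_sub_mul_pow (hlt p) ((p : ℂ) ^ (-(x * γ)))).hasProd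
    simpa only [hF, Function.comp_def, Equiv.prodComm_apply, Prod.swap, ← sub_eq_add_neg] using! this
  have hval : zetaPochInf x γ = W⁻¹ := hz.tprod_eq
  refine ⟨hz.multipliable, ?_, ?_⟩
  · rw [hval]; exact inv_ne_zero hW
  · rw [hval, inv_inv]; exact hpoch

/-- The list version of the product over the primes. -/
lemma zetaPochInfList_hasProd {γ : ℂ} (hγ : 0 < γ.re) (X : List ℂ)
    (hX : ∀ x ∈ X, 1 < (x * γ).re) :
    zetaPochInfList X γ ≠ 0 ∧
      HasProd (fun p : Nat.Primes =>
        (X.map fun x => qPochInf ((p : ℂ) ^ (-(x * γ))) ((p : ℂ) ^ (-γ))).prod)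
        (zetaPochInfList X γ)⁻¹ := by
  induction X with
  | nil => simp [zetaPochInfList]
  | cons x X ih =>
    obtain ⟨h1, h2⟩ := ih fun y hy => hX y (List.mem_cons_of_mem x hy)
    obtain ⟨-, h3, h4⟩ := zetaPochInf_hasProd hγ (hX x List.mem_cons_self)
    have e : zetaPochInfList (x :: X) γ = zetaPochInf x γ * zetaPochInfList X γ := by
      simp [zetaPochInfList]
    refine ⟨e ▸ mul_ne_zero h3 h1, ?_⟩
    rw [e, mul_inv]
    simpa only [List.map_cons, List.prod_cons] using h4.mul h2

end Zeta

/-! ### The Dirichlet series over all positive integers -/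

section Full

variable {a b c γ : ℂ}

lemma dixonSmall_local {p : ℕ} (hp : p.Prime) {t : ℝ}
    (h : ∀ x ∈ dixonListA a b c ++ dixonListB a b c, t ≤ (x * γ).re) :
    DixonSmall ((p : ℂ) ^ (-γ)) ((p : ℂ) ^ (-(a * γ))) ((p : ℂ) ^ (b * γ)) ((p : ℂ) ^ (c * γ))
      ((p : ℝ) ^ (-t)) := by
  have key : ∀ x ∈ dixonListA a b c ++ dixonListB a b c,
      ‖(p : ℂ) ^ (-(x * γ))‖ ≤ (p : ℝ) ^ (-t) := fun x hx => norm_prime_cpow_neg_le hp (h x hx)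
  simp only [dixonListA, dixonListB, List.cons_append, List.nil_append, List.mem_cons,
    List.not_mem_nil, or_false, forall_eq_or_imp, forall_eq,
    show 1 - b + a = 1 + a - b by ring, show 1 - c + a = 1 + a - c by ring,
    cpow_sub_mul _ γ _ hp.ne_zero, cpow_one_add_a a γ hp.ne_zero,
    cpow_two_mul_a_add_one a γ hp.ne_zero] at key
  obtain ⟨h1, h2, h3, h4, h5, h6, h7, h8⟩ := key
  exact ⟨h3, h6, h7, h4, h5, h1, h2, h8⟩

lemma localDixonParams_of_ne {p : ℕ} (hp : p.Prime) (hγ : 0 < γ.re)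
    (hz : 0 < ((1 + a - b - c) * γ).re)
    (h : ∀ j : ℕ, (p : ℂ) ^ (-((a + j) * γ)) ≠ -1 ∧ (p : ℂ) ^ (-((2 * a + 1 - b + j) * γ)) ≠ 1 ∧
      (p : ℂ) ^ (-((2 * a + 1 - c + j) * γ)) ≠ 1 ∧ (p : ℂ) ^ (-((1 + a + j) * γ)) ≠ 1) :
    LocalDixonParams a b c γ p := by
  simp only [cpow_add_nat_mul γ _ hp.ne_zero, cpow_sub_mul _ γ _ hp.ne_zero,
    cpow_one_add_a a γ hp.ne_zero, cpow_two_mul_a_add_one a γ hp.ne_zero] at h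
  refine ⟨norm_prime_cpow_neg_lt_one hp hγ, ?_, fun j hj => (h j).1 ?_, fun j hj => (h j).2.2.2 ?_,
    fun j hj => (h j).2.1 ?_, fun j hj => (h j).2.2.1 ?_⟩
  · have := norm_prime_cpow_neg_lt_one hp hz
    simpa only [cpow_sub_mul _ γ _ hp.ne_zero, cpow_one_add_a a γ hp.ne_zero] using this
  · exact eq_neg_of_add_eq_zero_right hj
  · exact (sub_eq_zero.mp hj).symm
  · exact (sub_eq_zero.mp hj).symm
  · exact (sub_eq_zero.mp hj).symm

/-- Only the factor `1 + A` of `(-A; q)_n` needs the hypothesis on `p^{-aγ}`: the other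
denominators have the form `1 - y` with `‖y‖ < 1`. -/
lemma localDixonParams_of_one_lt {p : ℕ} (hp : p.Prime) (hγ : 0 < γ.re)
    (h : ∀ x ∈ dixonListA a b c ++ dixonListB a b c, 1 < (x * γ).re)
    (ha : (p : ℂ) ^ (-(a * γ)) ≠ -1) : LocalDixonParams a b c γ p := by
  have hq : ‖(p : ℂ) ^ (-γ)‖ < 1 := norm_prime_cpow_neg_lt_one hp hγ
  have hs := dixonSmall_local hp (t := 1) fun x hx => (h x hx).le
  have hp1 : (p : ℝ) ^ (-1 : ℝ) < 1 :=
    Real.rpow_lt_one_of_one_lt_of_neg (by exact_mod_cast hp.one_lt) (by norm_num)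
  refine ⟨hq, hs.qAuv.trans_lt hp1, fun j => ?_, one_sub_mul_pow_ne_zero hq (hs.qA.trans_lt hp1),
    one_sub_mul_pow_ne_zero hq (hs.qAAu.trans_lt hp1),
    one_sub_mul_pow_ne_zero hq (hs.qAAv.trans_lt hp1)⟩
  cases j with
  | zero => exact fun e => ha (eq_neg_of_add_eq_zero_right (by simpa using e))
  | succ j =>
    have := one_sub_mul_pow_ne_zero hq
      ((norm_neg _).trans_lt (hs.qA.trans_lt hp1)) j
    convert this using 1
    ring

lemma exists_one_lt_le_re (h : ∀ x ∈ dixonListA a b c ++ dixonListB a b c, 1 < (x * γ).re) :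
    ∃ t : ℝ, 1 < t ∧ ∀ x ∈ dixonListA a b c ++ dixonListB a b c, t ≤ (x * γ).re := by
  generalize dixonListA a b c ++ dixonListB a b c = X at h
  induction X with
  | nil => exact ⟨2, one_lt_two, by simp⟩
  | cons y X ih =>
    obtain ⟨t, ht, hX⟩ := ih fun x hx => h x (List.mem_cons_of_mem y hx)
    refine ⟨min t (y * γ).re, lt_min ht (h y List.mem_cons_self), fun x hx => ?_⟩
    rcases List.mem_cons.mp hx with rfl | hx
    · exact min_le_right _ _
    · exact (min_le_left _ _).trans (hX x hx)

lemma summable_norm_thetaTerm (hγ : 0 < γ.re)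
    (h : ∀ x ∈ dixonListA a b c ++ dixonListB a b c, 1 < (x * γ).re)
    (ha : ∀ p : ℕ, p.Prime → (p : ℂ) ^ (-(a * γ)) ≠ -1) :
    Summable fun k : ℕ => ‖thetaTerm (dixonUpper a b c) (dixonLower a b c) γ
      ((1 + a - b - c) * γ) k‖ := by
  obtain ⟨t, ht, hX⟩ := exists_one_lt_le_re h
  have hz : 1 < ((1 + a - b - c) * γ).re := h _ (by simp [dixonListA])
  set r := (2 : ℝ) ^ (-γ.re) with hrdef
  have hr : r < 1 := Real.rpow_lt_one_of_one_lt_of_neg one_lt_two (by linarith)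
  set K := dixonBound r
  have hK : 0 ≤ K :=
    mul_nonneg (div_nonneg (by norm_num) (by linarith)) (Real.exp_nonneg _)
  have hδ : Summable fun n : ℕ => 2 * K * (n : ℝ) ^ (-t) :=
    (Real.summable_nat_rpow.mpr (by linarith)).mul_left _
  refine summable_norm_of_multiplicative (thetaTerm_zero _ _ _ _ fun e => ?_)
    (thetaTerm_one _ _ _ _) (fun hmn => thetaTerm_mul _ _ _ _ hmn) hδ (fun p => by positivity)
    (fun p hp => (hasSum_thetaTerm_prime_pow a b c γ hp
      (localDixonParams_of_one_lt hp hγ h (ha p hp))).1) fun p hp => ?_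
  · rw [e, Complex.zero_re] at hz; linarith
  · have hD := localDixonParams_of_one_lt hp hγ h (ha p hp)
    have hS := dixonSmall_local hp hX
    set δ := (p : ℝ) ^ (-t) with hδdef
    have hδ0 : 0 ≤ δ := by positivity
    have hδ2 : δ ≤ 1 / 2 := by
      calc δ ≤ (2 : ℝ) ^ (-t) :=
            Real.rpow_le_rpow_of_nonpos two_pos (by exact_mod_cast hp.two_le) (by linarith)
        _ ≤ (2 : ℝ) ^ (-1 : ℝ) := Real.rpow_le_rpow_of_exponent_le one_le_two (by linarith)
        _ = 1 / 2 := by rw [Real.rpow_neg_one]; norm_num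
    have hb := (summable_geometric_of_lt_one hδ0 (by linarith)).mul_left (K * δ)
    have hle (n : ℕ) : ‖thetaTerm (dixonUpper a b c) (dixonLower a b c) γ
        ((1 + a - b - c) * γ) (p ^ (n + 1))‖ ≤ K * δ * δ ^ n := by
      rw [thetaTerm_prime_pow _ _ _ _ hp, localCoeff_mul_pow a b c γ hp.ne_zero hD, mul_assoc,
        ← pow_succ']
      exact hS.norm_dixonTerm_succ_le hD.one_add_A_ne hr (norm_prime_cpow_neg_le_two hp hγ) hδ2 n
    refine ((hb.of_nonneg_of_le (fun _ => norm_nonneg _) hle).tsum_le_tsum hle hb).trans ?_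
    · rw [tsum_mul_left, tsum_geometric_of_lt_one hδ0 (by linarith)]
      have : (1 - δ)⁻¹ ≤ 2 := by
        rw [inv_le_comm₀ (by linarith) two_pos]; linarith
      calc _ ≤ K * δ * 2 := by gcongr
        _ = _ := by ring

/-- The Euler product of the series over all positive integers. -/
lemma hasSum_thetaTerm_pnat (hγ : 0 < γ.re)
    (h : ∀ x ∈ dixonListA a b c ++ dixonListB a b c, 1 < (x * γ).re)
    (ha : ∀ p : ℕ, p.Prime → (p : ℂ) ^ (-(a * γ)) ≠ -1) :
    HasSum (fun k : ℕ+ =>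
        thetaTerm (dixonUpper a b c) (dixonLower a b c) γ ((1 + a - b - c) * γ) k)
      (zetaPochInfList (dixonListA a b c) γ / zetaPochInfList (dixonListB a b c) γ) := by
  have hsum := summable_norm_thetaTerm hγ h ha
  have hz : 1 < ((1 + a - b - c) * γ).re := h _ (by simp [dixonListA])
  have h0 : thetaTerm (dixonUpper a b c) (dixonLower a b c) γ ((1 + a - b - c) * γ) 0 = 0 :=
    thetaTerm_zero _ _ _ _ fun e => by rw [e, Complex.zero_re] at hz; linarith
  have hE := EulerProduct.eulerProduct_hasProd (thetaTerm_one _ _ _ _)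
    (fun hmn => thetaTerm_mul _ _ _ _ hmn) hsum h0
  obtain ⟨hA0, hA⟩ := zetaPochInfList_hasProd hγ (dixonListA a b c)
    fun x hx => h x (List.mem_append_left _ hx)
  obtain ⟨hB0, hB⟩ := zetaPochInfList_hasProd hγ (dixonListB a b c)
    fun x hx => h x (List.mem_append_right _ hx)
  have hAB := hB.div₀ hA (inv_ne_zero hA0)
  have hloc (p : Nat.Primes) : ∑' e : ℕ, thetaTerm (dixonUpper a b c) (dixonLower a b c) γ
      ((1 + a - b - c) * γ) ((p : ℕ) ^ e) = _ :=
    (hasSum_thetaTerm_prime_pow a b c γ p.2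
      (localDixonParams_of_one_lt p.2 hγ h (ha p p.2))).2.tsum_eq.trans
      (dixonValue_local a b c γ p.2.ne_zero)
  simp only [hloc] at hE
  have hval := hE.unique hAB
  rw [inv_div_inv] at hval
  rw [← hval]
  have := hsum.of_norm.hasSum
  exact (PNat.coe_injective.hasSum_iff fun k hk => by
    obtain rfl : k = 0 := by
      by_contra hk0
      exact hk ⟨⟨k, Nat.pos_of_ne_zero hk0⟩, rfl⟩
    exact h0).mpr this

end Full

/-! ### The Dirichlet series over the integers composed of the primes dividing `m` -/

section Restricted

variable {a b c γ : ℂ} {m : ℕ}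

lemma primeSupportedOn_eq_factoredNumbers (hm : 0 < m) :
    primeSupportedOn m = Nat.factoredNumbers m.primeFactors := by
  ext k
  rw [Nat.mem_factoredNumbers_iff_primeFactors_subset]
  constructor
  · rintro ⟨hk, h⟩
    exact ⟨hk.ne', fun p hp => Nat.mem_primeFactors.mpr ⟨Nat.prime_of_mem_primeFactors hp,
      h p (Nat.prime_of_mem_primeFactors hp) (Nat.dvd_of_mem_primeFactors hp), hm.ne'⟩⟩
  · rintro ⟨hk, h⟩
    exact ⟨Nat.pos_of_ne_zero hk, fun p hp hpk =>
      Nat.dvd_of_mem_primeFactors (h (Nat.mem_primeFactors.mpr ⟨hp, hpk, hk⟩))⟩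

lemma JInfList_eq_prod (X : List ℂ) :
    JInfList m X γ = ∏ p ∈ m.primeFactors,
      (X.map fun x => qPochInf ((p : ℂ) ^ (-(x * γ))) ((p : ℂ) ^ (-γ))).prod := by
  induction X with
  | nil => simp [JInfList]
  | cons x X ih =>
    simp only [List.map_cons, List.prod_cons, Finset.prod_mul_distrib, ← ih]
    simp [JInfList, JInf]

lemma JInfList_dixonListA_ne_zero (h : ∀ p ∈ m.primeFactors, LocalDixonParams a b c γ p) :
    JInfList m (dixonListA a b c) γ ≠ 0 := by
  rw [JInfList_eq_prod]
  refine Finset.prod_ne_zero_iff.mpr fun p hp => ?_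
  have hp0 := (Nat.prime_of_mem_primeFactors hp).ne_zero
  have hD := h p hp
  simp only [dixonListA, List.map_cons, List.map_nil, List.prod_cons, List.prod_nil, mul_one,
    cpow_sub_mul _ γ _ hp0, cpow_one_add_a a γ hp0, cpow_two_mul_a_add_one a γ hp0]
  exact mul_ne_zero (qPochInf_ne_zero hD.norm_q hD.one_sub_u_ne)
    (mul_ne_zero (qPochInf_ne_zero hD.norm_q hD.one_sub_v_ne)
      (mul_ne_zero (qPochInf_ne_zero hD.norm_q hD.one_sub_ne)
        (qPochInf_ne_zero hD.norm_q (one_sub_mul_pow_ne_zero hD.norm_q hD.norm_z))))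

lemma hasSum_thetaTerm_primeSupportedOn (hm : 0 < m)
    (h : ∀ p ∈ m.primeFactors, LocalDixonParams a b c γ p) :
    HasSum (fun k : primeSupportedOn m =>
        thetaTerm (dixonUpper a b c) (dixonLower a b c) γ ((1 + a - b - c) * γ) k)
      (JInfList m (dixonListB a b c) γ / JInfList m (dixonListA a b c) γ) := by
  have hloc (p : ℕ) (hp : p ∈ m.primeFactors) :=
    hasSum_thetaTerm_prime_pow a b c γ (Nat.prime_of_mem_primeFactors hp) (h p hp)
  have := (hasSum_factoredNumbers_of_multiplicative
    (f := thetaTerm (dixonUpper a b c) (dixonLower a b c) γ ((1 + a - b - c) * γ))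
    (thetaTerm_one _ _ _ _) (fun hmn => thetaTerm_mul _ _ _ _ hmn) m.primeFactors
    (fun p hp => Nat.prime_of_mem_primeFactors hp) fun p hp => (hloc p hp).1).2
  rw [primeSupportedOn_eq_factoredNumbers hm, JInfList_eq_prod, JInfList_eq_prod,
    ← Finset.prod_div_distrib]
  convert this using 1
  refine Finset.prod_congr rfl fun p hp => ?_
  rw [(hloc p hp).2.tsum_eq, dixonValue_local a b c γ (Nat.prime_of_mem_primeFactors hp).ne_zero]

end Restricted

/-! ### Divisor sums -/

section DivisorSum

variable {s : ℂ}

lemma divisorSum_mul {m n : ℕ} (h : m.Coprime n) :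
    divisorSum s (m * n) = divisorSum s m * divisorSum s n := by
  rw [divisorSum, divisorSum, divisorSum, Nat.divisors_mul, Finset.mul_def,
    Finset.sum_image h.mul_injOn_divisors, Finset.sum_mul_sum, Finset.sum_product]
  refine Finset.sum_congr rfl fun i _ => Finset.sum_congr rfl fun j _ => ?_
  rw [Nat.cast_mul, Complex.natCast_mul_natCast_cpow]

lemma divisorSum_prime_pow {p : ℕ} (hp : p.Prime) (n : ℕ) :
    divisorSum s (p ^ n) = ∑ i ∈ Finset.range (n + 1), ((p : ℂ) ^ s) ^ i := by
  rw [divisorSum, Nat.sum_divisors_prime_pow hp]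
  refine Finset.sum_congr rfl fun i _ => ?_
  rw [Nat.cast_pow, ← Complex.natCast_cpow_natCast_mul, Complex.cpow_nat_mul]

/-- A divisor sum is multiplicative over a product of powers of distinct primes. -/
lemma divisorSum_prod_prime_pow (S : Finset ℕ) (hS : ∀ p ∈ S, p.Prime) (e : ℕ → ℕ) :
    divisorSum s (∏ p ∈ S, p ^ e p) = ∏ p ∈ S, divisorSum s (p ^ e p) := by
  induction S using Finset.induction with
  | empty => simp [divisorSum]
  | insert p S hp ih =>
    have hpp := hS p (Finset.mem_insert_self p S)
    have hS' : ∀ r ∈ S, r.Prime := fun r hr => hS r (Finset.mem_insert_of_mem hr)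
    rw [Finset.prod_insert hp, Finset.prod_insert hp, divisorSum_mul, ih hS']
    refine Nat.Coprime.prod_right fun r hr => Nat.Coprime.pow _ _ ?_
    exact (Nat.coprime_primes hpp (hS' r hr)).mpr fun e => hp (e ▸ hr)

/-- The quotients of geometric sums telescope to a quotient of `q`-Pochhammer symbols. -/
lemma prod_geom_sum_div {q : ℂ} (hq : ‖q‖ < 1) (N v : ℕ) :
    ∏ j ∈ Finset.range N, (∑ i ∈ Finset.range (v + j + 1), q ^ i) /
      (∑ i ∈ Finset.range (j + 1), q ^ i) = qPoch (q ^ (N + 1)) q v / qPoch q q v := by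
  have hq1 : q ≠ 1 := fun h => by simp [h] at hq
  have hv : qPoch q q v ≠ 0 := qPoch_ne_zero (one_sub_mul_pow_ne_zero hq hq) v
  induction N with
  | zero => simp [hv]
  | succ N ih =>
    have hN : 1 - q ^ (N + 1) ≠ 0 := by
      rw [pow_succ']; exact one_sub_mul_pow_ne_zero hq hq N
    have h1 : (∑ i ∈ Finset.range (v + N + 1), q ^ i) / (∑ i ∈ Finset.range (N + 1), q ^ i) =
        (1 - q ^ (N + 1) * q ^ v) / (1 - q ^ (N + 1)) := by
      rw [geom_sum_eq hq1, geom_sum_eq hq1, div_div_div_cancel_right₀ (sub_ne_zero.mpr hq1),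
        ← neg_div_neg_eq, neg_sub, neg_sub, ← pow_add, show v + N + 1 = N + 1 + v by ring]
    have h2 : qPoch (q ^ (N + 1 + 1)) q v =
        qPoch (q ^ (N + 1)) q v * ((1 - q ^ (N + 1) * q ^ v) / (1 - q ^ (N + 1))) := by
      rw [mul_div_assoc', eq_div_iff hN, ← qPoch_base_mul, ← pow_succ']
    rw [Finset.prod_range_succ, ih, h1, h2]
    ring

lemma sigmaSymbol_eq_prod {n k : ℕ} (hs : ∀ p : ℕ, p.Prime → ‖(p : ℂ) ^ s‖ < 1) (hn : 0 < n)
    (hk : 0 < k) :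
    sigmaSymbol s n k = ∏ p ∈ k.primeFactors,
      qPoch (((p : ℂ) ^ s) ^ n) ((p : ℂ) ^ s) (k.factorization p) /
        qPoch ((p : ℂ) ^ s) ((p : ℂ) ^ s) (k.factorization p) := by
  obtain ⟨N, rfl⟩ := Nat.exists_eq_add_of_le' hn
  have hprime : ∀ p ∈ k.primeFactors, p.Prime := fun p hp => Nat.prime_of_mem_primeFactors hp
  have hmul (j : ℕ) : k * ∏ p ∈ k.primeFactors, p ^ j =
      ∏ p ∈ k.primeFactors, p ^ (k.factorization p + j) := by
    simp only [pow_add, Finset.prod_mul_distrib]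
    congr 1
    exact (Nat.prod_factorization_pow_eq_self hk.ne').symm
  rw [sigmaSymbol, Nat.add_sub_cancel]
  simp only [hmul, divisorSum_prod_prime_pow _ hprime, ← Finset.prod_div_distrib]
  rw [Finset.prod_comm]
  refine Finset.prod_congr rfl fun p hp => ?_
  rw [← prod_geom_sum_div (hs p (hprime p hp))]
  refine Finset.prod_congr rfl fun j _ => ?_
  rw [divisorSum_prime_pow (hprime p hp), divisorSum_prime_pow (hprime p hp)]

lemma qPoch_sq (x q : ℂ) (n : ℕ) : qPoch (x ^ 2) (q ^ 2) n = qPoch x q n * qPoch (-x) q n := by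
  rw [qPoch, qPoch, qPoch, ← Finset.prod_mul_distrib]
  refine Finset.prod_congr rfl fun i _ => ?_
  ring

lemma cpow_neg_natCast_mul (p n : ℕ) (γ : ℂ) :
    (p : ℂ) ^ (-((n : ℂ) * γ)) = ((p : ℂ) ^ (-γ)) ^ n := by
  rw [← Complex.cpow_nat_mul]; congr 1; ring

/-- At positive integer parameters each local coefficient is a quotient of the local factors of
the symbols `σ_s(n; k)`; the parameters `-\1+a` and `-\a` come from the base `p^{-2γ}` through
`(x²; q²)_n = (x; q)_n (-x; q)_n`. -/
lemma thetaCoeff_eq_sigmaSymbol {γ : ℂ} (hγ : 0 < γ.re) {a b c k : ℕ} (ha : 0 < a) (hb : 0 < b)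
    (hc : 0 < c) (hba : b ≤ 2 * a) (hca : c ≤ 2 * a) (hk : 0 < k) :
    thetaCoeff (dixonUpper a b c) (dixonLower a b c) γ k =
      (sigmaSymbolList (-γ) [2 * a, b, c] k * sigmaSymbol (-(2 * γ)) (1 + a) k *
          sigmaSymbol (-γ) a k) /
        (sigmaSymbolList (-γ) [2 * a + 1 - b, 2 * a + 1 - c] k * sigmaSymbol (-(2 * γ)) a k *
          sigmaSymbol (-γ) (1 + a) k) := by
  have h1 : ∀ p : ℕ, p.Prime → ‖(p : ℂ) ^ (-γ)‖ < 1 := fun p hp =>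
    norm_prime_cpow_neg_lt_one hp hγ
  have h2 : ∀ p : ℕ, p.Prime → ‖(p : ℂ) ^ (-(2 * γ))‖ < 1 := fun p hp =>
    norm_prime_cpow_neg_lt_one hp (by simpa using hγ)
  simp only [sigmaSymbolList, List.map_cons, List.map_nil, List.prod_cons, List.prod_nil, mul_one]
  rw [sigmaSymbol_eq_prod h1 (by omega : 0 < 2 * a) hk, sigmaSymbol_eq_prod h1 hb hk,
    sigmaSymbol_eq_prod h1 hc hk, sigmaSymbol_eq_prod h2 (by omega : 0 < 1 + a) hk,
    sigmaSymbol_eq_prod h1 ha hk, sigmaSymbol_eq_prod h1 (by omega : 0 < 2 * a + 1 - b) hk,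
    sigmaSymbol_eq_prod h1 (by omega : 0 < 2 * a + 1 - c) hk, sigmaSymbol_eq_prod h2 ha hk,
    sigmaSymbol_eq_prod h1 (by omega : 0 < 1 + a) hk, thetaCoeff]
  simp only [← Finset.prod_mul_distrib, ← Finset.prod_div_distrib]
  refine Finset.prod_congr rfl fun p hp => ?_
  have hq := h1 p (Nat.prime_of_mem_primeFactors hp)
  generalize k.factorization p = n
  have e1 : (2 * (a : ℂ)) = ((2 * a : ℕ) : ℂ) := by push_cast; ring
  have e2 : (1 + (a : ℂ)) = ((1 + a : ℕ) : ℂ) := by push_cast; ring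
  have e3 : ((2 * a : ℕ) : ℂ) + 1 - b = ((2 * a + 1 - b : ℕ) : ℂ) := by
    rw [Nat.cast_sub (by omega)]; push_cast; ring
  have e4 : ((2 * a : ℕ) : ℂ) + 1 - c = ((2 * a + 1 - c : ℕ) : ℂ) := by
    rw [Nat.cast_sub (by omega)]; push_cast; ring
  have e5 : (p : ℂ) ^ (-(2 * γ)) = ((p : ℂ) ^ (-γ)) ^ 2 := by
    simpa using cpow_neg_natCast_mul p 2 γ
  simp only [localCoeff, dixonUpper, dixonLower, DParam.localVal, List.map_cons, List.map_nil,
    List.prod_cons, List.prod_nil, mul_one]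
  rw [e1, e2, e3, e4, e5]
  simp only [cpow_neg_natCast_mul]
  generalize (p : ℂ) ^ (-γ) = q at *
  have sq (N : ℕ) : qPoch ((q ^ 2) ^ N) (q ^ 2) n = qPoch (q ^ N) q n * qPoch (-q ^ N) q n := by
    rw [← qPoch_sq, ← pow_mul, ← pow_mul, mul_comm]
  have lt (N : ℕ) (hN : 0 < N) : ‖q ^ N‖ < 1 := by
    rw [norm_pow]; exact pow_lt_one₀ (norm_nonneg q) hq hN.ne'
  have ne (N : ℕ) (hN : 0 < N) : qPoch (q ^ N) q n ≠ 0 :=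
    qPoch_ne_zero (one_sub_mul_pow_ne_zero hq (lt N hN)) n
  have ne' (N : ℕ) (hN : 0 < N) : qPoch (-q ^ N) q n ≠ 0 :=
    qPoch_ne_zero (one_sub_mul_pow_ne_zero hq ((norm_neg _).trans_lt (lt N hN))) n
  have n0 : qPoch q q n ≠ 0 := by simpa using ne 1 one_pos
  have n1 : qPoch (q ^ 2) (q ^ 2) n ≠ 0 := by
    rw [qPoch_sq]
    exact mul_ne_zero n0 (by simpa using ne' 1 one_pos)
  have n2 := ne (1 + a) (by omega)
  have n3 := ne a ha
  have n4 := ne' a ha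
  have n5 := ne (2 * a + 1 - b) (by omega)
  have n6 := ne (2 * a + 1 - c) (by omega)
  rw [sq, sq]
  generalize qPoch (q ^ 2) (q ^ 2) n = X0 at *
  generalize qPoch (q ^ (1 + a)) q n = X1 at *
  generalize qPoch (-q ^ (1 + a)) q n = X2 at *
  generalize qPoch (q ^ a) q n = X3 at *
  generalize qPoch (-q ^ a) q n = X4 at *
  generalize qPoch (q ^ (2 * a + 1 - b)) q n = X5 at *
  generalize qPoch (q ^ (2 * a + 1 - c)) q n = X6 at *
  generalize qPoch (q ^ (2 * a)) q n = X7 at *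
  generalize qPoch q q n = X8 at *
  field_simp

end DivisorSum

theorem mainTheorem1 (γ : ℂ) (hγ : 0 < γ.re) :
    -- the Dirichlet series over all positive integers
    (∀ a b c : ℂ,
      (∀ x ∈ dixonListA a b c ++ dixonListB a b c, 1 < (x * γ).re) →
      (∀ p : ℕ, p.Prime → (p : ℂ) ^ (-(a * γ)) ≠ -1) →
      (∀ x ∈ dixonListA a b c ++ dixonListB a b c,
        Multipliable fun k : ℕ => riemannZeta ((x + k) * γ)) ∧
      zetaPochInfList (dixonListB a b c) γ ≠ 0 ∧
      HasSum
        (fun k : ℕ+ =>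
          thetaTerm (dixonUpper a b c) (dixonLower a b c) γ ((1 + a - b - c) * γ) k)
        (zetaPochInfList (dixonListA a b c) γ / zetaPochInfList (dixonListB a b c) γ)) ∧
    -- the Dirichlet series over the integers composed of the primes that divide `m`
    (∀ (a b c : ℂ) (m : ℕ), 0 < m →
      0 < ((1 + a - b - c) * γ).re →
      (∀ p ∈ m.primeFactors, ∀ j : ℕ,
        (p : ℂ) ^ (-((a + j) * γ)) ≠ -1 ∧
        (p : ℂ) ^ (-((2 * a + 1 - b + j) * γ)) ≠ 1 ∧
        (p : ℂ) ^ (-((2 * a + 1 - c + j) * γ)) ≠ 1 ∧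
        (p : ℂ) ^ (-((1 + a + j) * γ)) ≠ 1) →
      (∀ x ∈ dixonListA a b c ++ dixonListB a b c, ∀ p ∈ m.primeFactors,
        Multipliable fun i : ℕ => 1 - (p : ℂ) ^ (-(x * γ)) * ((p : ℂ) ^ (-γ)) ^ i) ∧
      JInfList m (dixonListA a b c) γ ≠ 0 ∧
      HasSum
        (fun k : primeSupportedOn m =>
          thetaTerm (dixonUpper a b c) (dixonLower a b c) γ ((1 + a - b - c) * γ) k)
        (JInfList m (dixonListB a b c) γ / JInfList m (dixonListA a b c) γ)) ∧
    -- at positive integer parameters the coefficients are quotients of divisor sums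
    (∀ a b c k : ℕ, 0 < a → 0 < b → 0 < c → b ≤ 2 * a → c ≤ 2 * a → 0 < k →
      thetaCoeff (dixonUpper a b c) (dixonLower a b c) γ k =
        (sigmaSymbolList (-γ) [2 * a, b, c] k * sigmaSymbol (-(2 * γ)) (1 + a) k *
            sigmaSymbol (-γ) a k) /
          (sigmaSymbolList (-γ) [2 * a + 1 - b, 2 * a + 1 - c] k * sigmaSymbol (-(2 * γ)) a k *
            sigmaSymbol (-γ) (1 + a) k)) := by
  refine ⟨fun a b c h ha => ⟨fun x hx => (zetaPochInf_hasProd hγ (h x hx)).1, ?_,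
    hasSum_thetaTerm_pnat hγ h ha⟩, fun a b c m hm hz h => ?_,
    fun a b c k ha hb hc hba hca hk => thetaCoeff_eq_sigmaSymbol hγ ha hb hc hba hca hk⟩
  · exact (zetaPochInfList_hasProd hγ _ fun x hx => h x (List.mem_append_right _ hx)).1
  · have hD : ∀ p ∈ m.primeFactors, LocalDixonParams a b c γ p := fun p hp =>
      localDixonParams_of_ne (Nat.prime_of_mem_primeFactors hp) hγ hz (h p hp)
    exact ⟨fun x _ p hp => multipliable_one_sub_mul_pow
      (norm_prime_cpow_neg_lt_one (Nat.prime_of_mem_primeFactors hp) hγ) _,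
      JInfList_dixonListA_ne_zero hD, hasSum_thetaTerm_primeSupportedOn hm hD⟩
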